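/- There is a function $C:(0,\infty)\to(0,\infty)$ with the following property. Let $\Omega\subset\mathbb{R}^3$ be an arbitrary bounded domain (nonempty, open, connected; no regularity of the boundary is assumed), with Lebesgue measure $\lambda(\Omega)$, and let $f\in L^2(\Omega)$ be real-valued. Let $H^1_0(\Omega)$ be the closure of $C_c^\infty(\Omega)$ in $H^1(\Omega)$, and let $u\in H^1_0(\Omega)$ be the weak solution of $-\Delta u=f$ in $\Omega$ with $u=0$ on $\partial\Omega$, that is, $$\int_\Omega \nabla u\cdot\nabla v\,dx=\int_\Omega f v\,dx\qquad\text{for all } v\in H^1_0(\Omega).$$ Then $u\in C(\Omega)\cap L^\infty(\Omega)$ (that is, $u$ is essentially bounded and coincides almost everywhere in $\Omega$ with a function continuous on $\Omega$), and $$\|u\|_{L^\infty(\Omega)}\le C(\lambda(\Omega))\,\|f\|_{L^2(\Omega)}.$$ -/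

import Mathlib

open MeasureTheory Filter Topology

namespace DirichletPoisson

/-- `φ ∈ C_c^∞(Ω)`: smooth on `ℝⁿ`, with compact support contained in `Ω`. -/
structure IsTestFunction {n : ℕ} (Ω : Set (EuclideanSpace ℝ (Fin n)))
    (φ : EuclideanSpace ℝ (Fin n) → ℝ) : Prop where
  smooth : ContDiff ℝ ((⊤ : ℕ∞) : WithTop ℕ∞) φ
  hasCompactSupport : HasCompactSupport φ
  tsupport_subset : tsupport φ ⊆ Ω

/-- `u ∈ H¹(Ω)` with weak gradient `G`: both are square integrable on `Ω`, and
`∫_Ω u ∂ᵢφ = - ∫_Ω Gᵢ φ` for every test function `φ` and every coordinate `i`.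
Functions on `Ω` are represented by functions on `ℝⁿ`, whose values outside `Ω` play no role. -/
structure IsH1 {n : ℕ} (Ω : Set (EuclideanSpace ℝ (Fin n)))
    (u : EuclideanSpace ℝ (Fin n) → ℝ)
    (G : EuclideanSpace ℝ (Fin n) → EuclideanSpace ℝ (Fin n)) : Prop where
  memLp : MemLp u 2 (volume.restrict Ω)
  memLp_grad : MemLp G 2 (volume.restrict Ω)
  weak_grad : ∀ φ : EuclideanSpace ℝ (Fin n) → ℝ, IsTestFunction Ω φ → ∀ i : Fin n,
    ∫ x in Ω, u x * (gradient φ x) i = - ∫ x in Ω, (G x) i * φ x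

/-- `u ∈ H¹₀(Ω)` with weak gradient `G`: `u` lies in the closure of `C_c^∞(Ω)` in `H¹(Ω)`. -/
structure IsH10 {n : ℕ} (Ω : Set (EuclideanSpace ℝ (Fin n)))
    (u : EuclideanSpace ℝ (Fin n) → ℝ)
    (G : EuclideanSpace ℝ (Fin n) → EuclideanSpace ℝ (Fin n)) : Prop where
  isH1 : IsH1 Ω u G
  approx : ∃ φ : ℕ → EuclideanSpace ℝ (Fin n) → ℝ,
    (∀ k, IsTestFunction Ω (φ k)) ∧
    Tendsto (fun k => eLpNorm (fun x => φ k x - u x) 2 (volume.restrict Ω)) atTop (𝓝 0) ∧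
    Tendsto (fun k => eLpNorm (fun x => gradient (φ k) x - G x) 2 (volume.restrict Ω))
      atTop (𝓝 0)

/-- `u` is a weak solution of `-Δu = f` in `Ω`, `u = 0` on `∂Ω`: `u ∈ H¹₀(Ω)` and
`∫_Ω ∇u · ∇v = ∫_Ω f v` for all `v ∈ H¹₀(Ω)` (weak gradients are unique almost everywhere). -/
def IsWeakSolution {n : ℕ} (Ω : Set (EuclideanSpace ℝ (Fin n)))
    (f u : EuclideanSpace ℝ (Fin n) → ℝ) : Prop :=
  ∃ G : EuclideanSpace ℝ (Fin n) → EuclideanSpace ℝ (Fin n), IsH10 Ω u G ∧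
    ∀ (v : EuclideanSpace ℝ (Fin n) → ℝ)
      (H : EuclideanSpace ℝ (Fin n) → EuclideanSpace ℝ (Fin n)), IsH10 Ω v H →
      ∫ x in Ω, inner ℝ (G x) (H x) = ∫ x in Ω, f x * v x

end DirichletPoisson

/-! The three-dimensional kernel `1/|x - y|` is square integrable near its singularity. By
Cauchy–Schwarz, the Newtonian potential of a density `g` on `Ω` is therefore bounded by `B ‖g‖₂`,
where `B` depends only on the measure of `Ω` (`abs_newtonPotential_le`). Both conclusions come from
this bound.

For the sup bound, take a test function `g` close to `f` in `L²` and shift its potential to `W = N g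
+ B ‖g‖₂`. Then `W` is smooth and nonnegative, satisfies `-ΔW = g`, and is at most `2 B ‖g‖₂`. Since
`W ≥ 0`, a smoothed positive part of `φ - W` is a test function on `Ω` whenever `φ` is, so no
boundary regularity is needed. Testing the equation with it is the weak maximum principle, and it
shows that the smoothed positive part of `u - W` has `L²` norm at most a Poincaré constant squared
times `‖f - g‖₂` (`eLpNorm_smoothRamp_sub_le`). The Poincaré constant may depend on `Ω` itself, but
it disappears as `g → f`, leaving `u ≤ 2 B ‖f‖₂` (`ae_le_of_isH10`). The lower bound follows by
symmetry.

For continuity, a cutoff `η` makes `ηu` solve a Poisson equation on the whole space with an `L²`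
source. By duality `ηu` is almost everywhere the potential of that source
(`ae_eq_newtonPotential_cutoffSource`), and such potentials are continuous as uniform limits of
smooth ones. The local representatives are then glued. -/

namespace DirichletPoisson

open scoped ContDiff Convolution

/-! ### Smooth calculus and Green's identities -/

section Smooth

variable {n : ℕ}

/-- The Laplacian, as the sum of the second partial derivatives. -/
noncomputable def laplacian (v : EuclideanSpace ℝ (Fin n) → ℝ) (x : EuclideanSpace ℝ (Fin n)) : ℝ :=
  ∑ i, gradient (fun y => gradient v y i) x i

theorem gradient_apply_eq_fderiv (v : EuclideanSpace ℝ (Fin n) → ℝ)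
    (x : EuclideanSpace ℝ (Fin n)) (i : Fin n) :
    gradient v x i = fderiv ℝ v x (EuclideanSpace.single i 1) := by
  have h : inner ℝ (gradient v x) (EuclideanSpace.single i (1 : ℝ))
      = fderiv ℝ v x (EuclideanSpace.single i 1) := by
    rw [gradient, InnerProductSpace.toDual_symm_apply]
  rw [← h, EuclideanSpace.inner_single_right]
  simp

theorem norm_gradient (v : EuclideanSpace ℝ (Fin n) → ℝ) (x : EuclideanSpace ℝ (Fin n)) :
    ‖gradient v x‖ = ‖fderiv ℝ v x‖ := by
  rw [gradient, LinearIsometryEquiv.norm_map]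

theorem inner_eq_sum_mul (a b : EuclideanSpace ℝ (Fin n)) :
    inner ℝ a b = ∑ i, a i * b i := by
  simp [PiLp.inner_apply, mul_comm]

theorem contDiff_partial {v : EuclideanSpace ℝ (Fin n) → ℝ} (hv : ContDiff ℝ ∞ v) (i : Fin n) :
    ContDiff ℝ ∞ (fun x => gradient v x i) := by
  simp_rw [gradient_apply_eq_fderiv]
  exact (hv.fderiv_right (m := ∞) (by simp)).clm_apply contDiff_const

theorem continuous_gradient {v : EuclideanSpace ℝ (Fin n) → ℝ} (hv : ContDiff ℝ ∞ v) :
    Continuous (gradient v) :=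
  (InnerProductSpace.toDual ℝ (EuclideanSpace ℝ (Fin n))).symm.continuous.comp
    (hv.continuous_fderiv (by simp))

theorem continuous_laplacian {v : EuclideanSpace ℝ (Fin n) → ℝ} (hv : ContDiff ℝ ∞ v) :
    Continuous (laplacian v) :=
  continuous_finsetSum _ fun i _ => (contDiff_partial (contDiff_partial hv i) i).continuous

theorem gradient_mul {v w : EuclideanSpace ℝ (Fin n) → ℝ} (hv : ContDiff ℝ ∞ v)
    (hw : ContDiff ℝ ∞ w) (x : EuclideanSpace ℝ (Fin n)) :
    gradient (fun y => v y * w y) x = v x • gradient w x + w x • gradient v x := by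
  rw [gradient, fderiv_fun_mul (hv.differentiable (by simp) x) (hw.differentiable (by simp) x)]
  simp [gradient]

theorem gradient_eq_zero_of_notMem_tsupport {v : EuclideanSpace ℝ (Fin n) → ℝ}
    {x : EuclideanSpace ℝ (Fin n)} (hx : x ∉ tsupport v) : gradient v x = 0 := by
  rw [gradient, fderiv_of_notMem_tsupport (𝕜 := ℝ) hx, map_zero]

theorem tsupport_partial_subset (v : EuclideanSpace ℝ (Fin n) → ℝ) (i : Fin n) :
    tsupport (fun x => gradient v x i) ⊆ tsupport v := by
  refine closure_minimal (fun x hx => ?_) (isClosed_tsupport v)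
  by_contra h
  exact hx (by simp [gradient_eq_zero_of_notMem_tsupport h])

theorem tsupport_gradient_subset (v : EuclideanSpace ℝ (Fin n) → ℝ) :
    tsupport (gradient v) ⊆ tsupport v := by
  refine closure_minimal (fun x hx => ?_) (isClosed_tsupport v)
  by_contra h
  exact hx (gradient_eq_zero_of_notMem_tsupport h)

theorem integral_mul_partial {a φ : EuclideanSpace ℝ (Fin n) → ℝ} (ha : ContDiff ℝ ∞ a)
    (hφ : ContDiff ℝ ∞ φ) (hc : HasCompactSupport φ) (i : Fin n) :
    ∫ x, a x * gradient φ x i = - ∫ x, gradient a x i * φ x := by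
  have hc' : HasCompactSupport (fun x => gradient φ x i) :=
    hc.mono' ((subset_tsupport _).trans (tsupport_partial_subset φ i))
  have h1 : Integrable (fun x => gradient a x i * φ x) :=
    ((contDiff_partial ha i).continuous.mul hφ.continuous).integrable_of_hasCompactSupport
      hc.mul_left
  have h2 : Integrable (fun x => a x * gradient φ x i) :=
    (ha.continuous.mul (contDiff_partial hφ i).continuous).integrable_of_hasCompactSupport
      hc'.mul_left
  have h3 : Integrable (fun x => a x * φ x) :=
    (ha.continuous.mul hφ.continuous).integrable_of_hasCompactSupport hc.mul_left
  simp only [gradient_apply_eq_fderiv] at *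
  exact integral_mul_fderiv_eq_neg_fderiv_mul_of_integrable h1 h2 h3
    (fun x _ => ha.differentiable (by simp) x) (fun x _ => hφ.differentiable (by simp) x)

theorem integral_inner_gradient {a φ : EuclideanSpace ℝ (Fin n) → ℝ} (ha : ContDiff ℝ ∞ a)
    (hφ : ContDiff ℝ ∞ φ) (hc : HasCompactSupport φ) :
    ∫ x, inner ℝ (gradient a x) (gradient φ x) = - ∫ x, laplacian a x * φ x := by
  have hc' : ∀ i, HasCompactSupport (fun x => gradient φ x i) := fun i =>
    hc.mono' ((subset_tsupport _).trans (tsupport_partial_subset φ i))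
  simp_rw [inner_eq_sum_mul, laplacian, Finset.sum_mul]
  rw [integral_finsetSum, integral_finsetSum, ← Finset.sum_neg_distrib]
  · exact Finset.sum_congr rfl fun i _ => integral_mul_partial (contDiff_partial ha i) hφ hc i
  · exact fun i _ => ((contDiff_partial (contDiff_partial ha i) i).continuous.mul
      hφ.continuous).integrable_of_hasCompactSupport hc.mul_left
  · exact fun i _ => ((contDiff_partial ha i).continuous.mul
      (contDiff_partial hφ i).continuous).integrable_of_hasCompactSupport (hc' i).mul_left

/-- Both sides equal `-∫ ∇a · ∇φ`. Compact support of `φ` alone removes the boundary terms, so `a`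
may be a regularised kernel without compact support. -/
theorem integral_mul_laplacian {a φ : EuclideanSpace ℝ (Fin n) → ℝ} (ha : ContDiff ℝ ∞ a)
    (hφ : ContDiff ℝ ∞ φ) (hc : HasCompactSupport φ) :
    ∫ x, a x * laplacian φ x = ∫ x, laplacian a x * φ x := by
  have hc' : ∀ i, HasCompactSupport (fun x => gradient φ x i) := fun i =>
    hc.mono' ((subset_tsupport _).trans (tsupport_partial_subset φ i))
  have hc'' : ∀ i, HasCompactSupport (fun x => gradient (fun y => gradient φ y i) x i) := fun i =>
    (hc' i).mono' ((subset_tsupport _).trans (tsupport_partial_subset _ i))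
  rw [← neg_inj, ← integral_inner_gradient ha hφ hc]
  simp_rw [inner_eq_sum_mul, laplacian, Finset.mul_sum]
  rw [integral_finsetSum, integral_finsetSum, ← Finset.sum_neg_distrib]
  · refine Finset.sum_congr rfl fun i _ => ?_
    rw [integral_mul_partial ha (contDiff_partial hφ i) (hc' i), neg_neg]
  · exact fun i _ => ((contDiff_partial ha i).continuous.mul
      (contDiff_partial hφ i).continuous).integrable_of_hasCompactSupport (hc' i).mul_left
  · exact fun i _ => (ha.continuous.mul (contDiff_partial
      (contDiff_partial hφ i) i).continuous).integrable_of_hasCompactSupport (hc'' i).mul_left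

end Smooth

/-! ### Test functions, their density in `L²`, and Cauchy–Schwarz -/

section TestFunction

variable {n : ℕ} {Ω : Set (EuclideanSpace ℝ (Fin n))}

theorem setIntegral_eq_integral_of_tsupport_subset {E : Type*} [NormedAddCommGroup E]
    [NormedSpace ℝ E] {a : EuclideanSpace ℝ (Fin n) → E} (ha : tsupport a ⊆ Ω) :
    ∫ x in Ω, a x = ∫ x, a x :=
  setIntegral_eq_integral_of_forall_compl_eq_zero fun _ hx =>
    image_eq_zero_of_notMem_tsupport fun h => hx (ha h)

namespace IsTestFunction

variable {φ : EuclideanSpace ℝ (Fin n) → ℝ}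

theorem mul_right (hφ : IsTestFunction Ω φ) {v : EuclideanSpace ℝ (Fin n) → ℝ}
    (hv : ContDiff ℝ ∞ v) : IsTestFunction Ω (fun x => φ x * v x) :=
  ⟨hφ.smooth.mul hv, hφ.hasCompactSupport.mul_right,
    (tsupport_mul_subset_left).trans hφ.tsupport_subset⟩

theorem partialDeriv (hφ : IsTestFunction Ω φ) (i : Fin n) :
    IsTestFunction Ω (fun x => gradient φ x i) :=
  ⟨contDiff_partial hφ.smooth i,
    hφ.hasCompactSupport.mono' ((subset_tsupport _).trans (tsupport_partial_subset φ i)),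
    (tsupport_partial_subset φ i).trans hφ.tsupport_subset⟩

theorem laplacian (hφ : IsTestFunction Ω φ) : IsTestFunction Ω (laplacian φ) := by
  have hsub : tsupport (DirichletPoisson.laplacian φ) ⊆ tsupport φ := by
    refine closure_minimal (fun x hx => ?_) (isClosed_tsupport φ)
    by_contra h
    refine hx (Finset.sum_eq_zero fun i _ => ?_)
    rw [gradient_eq_zero_of_notMem_tsupport fun h' => h (tsupport_partial_subset φ i h')]
    rfl
  refine ⟨?_, hφ.hasCompactSupport.mono' ((subset_tsupport _).trans hsub),
    hsub.trans hφ.tsupport_subset⟩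
  exact ContDiff.sum fun i _ => contDiff_partial (contDiff_partial hφ.smooth i) i

theorem hasCompactSupport_gradient (hφ : IsTestFunction Ω φ) :
    HasCompactSupport (gradient φ) :=
  hφ.hasCompactSupport.mono' ((subset_tsupport _).trans (tsupport_gradient_subset φ))

theorem memLp (hφ : IsTestFunction Ω φ) (p : ENNReal)
    (μ : Measure (EuclideanSpace ℝ (Fin n))) [IsFiniteMeasureOnCompacts μ] : MemLp φ p μ :=
  hφ.smooth.continuous.memLp_of_hasCompactSupport hφ.hasCompactSupport

theorem memLp_gradient (hφ : IsTestFunction Ω φ) (p : ENNReal)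
    (μ : Measure (EuclideanSpace ℝ (Fin n))) [IsFiniteMeasureOnCompacts μ] :
    MemLp (gradient φ) p μ :=
  (continuous_gradient hφ.smooth).memLp_of_hasCompactSupport hφ.hasCompactSupport_gradient

theorem isH10 (hφ : IsTestFunction Ω φ) : IsH10 Ω φ (gradient φ) := by
  refine ⟨⟨hφ.memLp 2 _, hφ.memLp_gradient 2 _, fun ψ hψ i => ?_⟩, fun _ => φ, fun _ => hφ, ?_, ?_⟩
  · rw [setIntegral_eq_integral_of_tsupport_subset, setIntegral_eq_integral_of_tsupport_subset,
      integral_mul_partial hφ.smooth hψ.smooth hψ.hasCompactSupport]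
    · exact tsupport_mul_subset_right.trans hψ.tsupport_subset
    · exact tsupport_mul_subset_right.trans (hψ.partialDeriv i).tsupport_subset
  · simp
  · simp

end IsTestFunction

theorem isTestFunction_zero : IsTestFunction Ω (fun _ => (0 : ℝ)) :=
  ⟨contDiff_const, HasCompactSupport.zero, by simp [tsupport]⟩

theorem IsTestFunction.add {φ ψ : EuclideanSpace ℝ (Fin n) → ℝ} (hφ : IsTestFunction Ω φ)
    (hψ : IsTestFunction Ω ψ) : IsTestFunction Ω (fun x => φ x + ψ x) :=
  ⟨hφ.smooth.add hψ.smooth, hφ.hasCompactSupport.add hψ.hasCompactSupport,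
    (tsupport_add φ ψ).trans (Set.union_subset hφ.tsupport_subset hψ.tsupport_subset)⟩

/-- An `L²` function orthogonal to all test functions vanishes almost everywhere on `Ω`, by the
fundamental lemma of the calculus of variations. Hence the subspace of test functions has trivial
orthogonal complement and is dense. -/
theorem exists_isTestFunction_eLpNorm_sub_le (hΩ : IsOpen Ω) {f : EuclideanSpace ℝ (Fin n) → ℝ}
    (hf : MemLp f 2 (volume.restrict Ω)) {ε : ℝ} (hε : 0 < ε) :
    ∃ g, IsTestFunction Ω g ∧
      eLpNorm (fun x => f x - g x) 2 (volume.restrict Ω) ≤ ENNReal.ofReal ε := by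
  let S : Submodule ℝ (Lp ℝ 2 (volume.restrict Ω)) :=
    { carrier := {F | ∃ g, IsTestFunction Ω g ∧ F =ᵐ[volume.restrict Ω] g}
      add_mem' := by
        rintro F F' ⟨g, hg, hF⟩ ⟨g', hg', hF'⟩
        refine ⟨_, hg.add hg', (Lp.coeFn_add F F').trans (hF.add hF')⟩
      zero_mem' := ⟨_, isTestFunction_zero, Lp.coeFn_zero _ _ _⟩
      smul_mem' := by
        rintro c F ⟨g, hg, hF⟩
        refine ⟨_, hg.mul_right (contDiff_const (c := c)), (Lp.coeFn_smul c F).trans ?_⟩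
        filter_upwards [hF] with x hx
        simp [hx, mul_comm] }
  have hS : S.topologicalClosure = ⊤ := by
    rw [Submodule.topologicalClosure_eq_top_iff, Submodule.eq_bot_iff]
    intro F hF
    have hF2 : MemLp F 2 (volume.restrict Ω) := Lp.memLp F
    have h0 : ∀ᵐ x, x ∈ Ω → F x = 0 := by
      refine hΩ.ae_eq_zero_of_integral_contDiff_smul_eq_zero ?_ ?_
      · refine LocallyIntegrableOn.mono_set (s := Set.univ ∩ Ω) ?_ (by simp)
        intro x hx
        obtain ⟨K, hK, hxK, hKΩ⟩ := exists_compact_subset hΩ hx.2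
        refine ⟨K, mem_nhdsWithin_of_mem_nhds (mem_interior_iff_mem_nhds.1 hxK), ?_⟩
        have : IsFiniteMeasure ((volume.restrict Ω).restrict K) :=
          ⟨by rw [Measure.restrict_apply_univ]; exact hK.measure_lt_top⟩
        have h := (hF2.mono_measure
          (Measure.restrict_le_self (s := K))).integrable (by norm_num)
        rwa [Measure.restrict_restrict_of_subset hKΩ] at h
      · intro g hg1 hg2 hg3
        have hg : IsTestFunction Ω g := ⟨hg1, hg2, hg3⟩
        have hm := hg.memLp 2 (volume.restrict Ω)
        have := (Submodule.mem_orthogonal S F).1 hF hm.toLp ⟨g, hg, hm.coeFn_toLp⟩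
        rw [L2.inner_def] at this
        rw [← setIntegral_eq_integral_of_forall_compl_eq_zero (s := Ω), ← this]
        · refine integral_congr_ae ?_
          filter_upwards [hm.coeFn_toLp] with x hx
          rw [hx]; simp [mul_comm]
        · intro x hx
          rw [image_eq_zero_of_notMem_tsupport fun h => hx (hg3 h), zero_smul]
    rw [Lp.eq_zero_iff_ae_eq_zero]
    exact (ae_restrict_iff' hΩ.measurableSet).2 h0
  have hmem : hf.toLp ∈ closure (S : Set (Lp ℝ 2 (volume.restrict Ω))) := by
    rw [← Submodule.topologicalClosure_coe, hS]; trivial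
  obtain ⟨F, ⟨g, hg, hFg⟩, hd⟩ := Metric.mem_closure_iff.1 hmem ε hε
  refine ⟨g, hg, ?_⟩
  rw [Lp.dist_def] at hd
  have heq : eLpNorm (fun x => f x - g x) 2 (volume.restrict Ω)
      = eLpNorm (⇑hf.toLp - ⇑F) 2 (volume.restrict Ω) := by
    refine eLpNorm_congr_ae ?_
    filter_upwards [hf.coeFn_toLp, hFg] with x h1 h2
    simp [h1, h2]
  rw [heq]
  refine (ENNReal.le_ofReal_iff_toReal_le ?_ hε.le).2 hd.le
  exact ((Lp.memLp _).sub (Lp.memLp _)).eLpNorm_ne_top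

theorem abs_integral_inner_le {α E : Type*} [MeasurableSpace α] {μ : Measure α}
    [NormedAddCommGroup E] [InnerProductSpace ℝ E] {a b : α → E} (ha : MemLp a 2 μ)
    (hb : MemLp b 2 μ) :
    |∫ x, inner ℝ (a x) (b x) ∂μ| ≤ (eLpNorm a 2 μ).toReal * (eLpNorm b 2 μ).toReal := by
  have h : ∫ x, inner ℝ (a x) (b x) ∂μ = inner ℝ (ha.toLp a) (hb.toLp b) := by
    rw [L2.inner_def]
    refine integral_congr_ae ?_
    filter_upwards [ha.coeFn_toLp, hb.coeFn_toLp] with x h1 h2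
    rw [h1, h2]
  rw [h, ← Lp.norm_toLp a ha, ← Lp.norm_toLp b hb]
  exact abs_real_inner_le_norm _ _

theorem integrable_inner_of_memLp {α E : Type*} [MeasurableSpace α] {μ : Measure α}
    [NormedAddCommGroup E] [InnerProductSpace ℝ E] {a b : α → E} (ha : MemLp a 2 μ)
    (hb : MemLp b 2 μ) : Integrable (fun x => inner ℝ (a x) (b x)) μ := by
  refine (L2.integrable_inner (𝕜 := ℝ) (ha.toLp a) (hb.toLp b)).congr ?_
  filter_upwards [ha.coeFn_toLp, hb.coeFn_toLp] with x h1 h2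
  rw [h1, h2]

theorem toReal_eLpNorm_sq {α E : Type*} [MeasurableSpace α] {μ : Measure α}
    [NormedAddCommGroup E] [InnerProductSpace ℝ E] {a : α → E} (ha : MemLp a 2 μ) :
    (eLpNorm a 2 μ).toReal ^ 2 = ∫ x, ‖a x‖ ^ 2 ∂μ := by
  rw [← Lp.norm_toLp a ha, ← real_inner_self_eq_norm_sq, L2.inner_def]
  refine integral_congr_ae ?_
  filter_upwards [ha.coeFn_toLp] with x h1
  rw [h1, real_inner_self_eq_norm_sq]

theorem abs_integral_mul_le {α : Type*} [MeasurableSpace α] {μ : Measure α}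
    {a b : α → ℝ} (ha : MemLp a 2 μ) (hb : MemLp b 2 μ) :
    |∫ x, a x * b x ∂μ| ≤ (eLpNorm a 2 μ).toReal * (eLpNorm b 2 μ).toReal := by
  simpa [mul_comm] using abs_integral_inner_le ha hb

end TestFunction

/-! ### Square integrability of the kernel `1/|x - y|` -/

section Kernel

/-- In polar coordinates the Jacobian `r²` cancels `r⁻²` exactly. This is where dimension three
enters the estimate. -/
theorem integrableOn_inv_norm_sq_ball :
    IntegrableOn (fun x : EuclideanSpace ℝ (Fin 3) => (‖x‖⁻¹) ^ 2) (Metric.ball 0 1) := by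
  have h := (integrable_fun_norm_addHaar (E := EuclideanSpace ℝ (Fin 3)) volume
    (f := (Set.Iio (1 : ℝ)).indicator fun r => (r⁻¹) ^ 2)).2 ?_
  · rw [← integrable_indicator_iff Metric.isOpen_ball.measurableSet]
    refine h.congr (ae_of_all _ fun x => ?_)
    by_cases hx : ‖x‖ < 1 <;> simp [Set.indicator, hx]
  · have : IntegrableOn ((Set.Iio (1 : ℝ)).indicator fun _ => (1 : ℝ)) (Set.Ioi 0) := by
      rw [integrableOn_indicator_iff measurableSet_Iio, Set.Iio_inter_Ioi]
      exact integrableOn_const (by simp)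
    refine this.congr_fun (fun y hy => ?_) measurableSet_Ioi
    have hy0 : y ≠ 0 := (Set.mem_Ioi.1 hy).ne'
    by_cases h1 : y < 1 <;> simp [Set.indicator, h1, hy0]

/-- A bound for the `L²` norm of `y ↦ ‖x - y‖⁻¹` on sets of measure `m`. -/
noncomputable def kernelBound (m : ℝ) : ℝ :=
  √((∫ x : EuclideanSpace ℝ (Fin 3) in Metric.ball 0 1, (‖x‖⁻¹) ^ 2) + m)

variable {Ω : Set (EuclideanSpace ℝ (Fin 3))}

/-- Near-far splitting: the near part has an integral independent of `x` and `Ω`, and the far part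
contributes at most the measure of `Ω`. So only the measure enters `kernelBound`. -/
theorem inv_norm_sub_sq_le (x y : EuclideanSpace ℝ (Fin 3)) :
    (‖x - y‖⁻¹) ^ 2 ≤ (Metric.ball (0 : EuclideanSpace ℝ (Fin 3)) 1).indicator
      (fun z => (‖z‖⁻¹) ^ 2) (x - y) + 1 := by
  by_cases h : ‖x - y‖ < 1
  · simp [Set.indicator, h]
  · have h' : ‖x - y‖⁻¹ ≤ 1 := inv_le_one_of_one_le₀ (not_lt.1 h)
    simp only [Set.indicator, Metric.mem_ball, dist_zero_right, h, if_false, zero_add]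
    exact pow_le_one₀ (by positivity) h'

theorem aestronglyMeasurable_inv_norm_sub (x : EuclideanSpace ℝ (Fin 3))
    (μ : Measure (EuclideanSpace ℝ (Fin 3))) :
    AEStronglyMeasurable (fun y => ‖x - y‖⁻¹) μ := by
  have : Measurable (fun y : EuclideanSpace ℝ (Fin 3) => ‖x - y‖⁻¹) := by fun_prop
  exact this.aestronglyMeasurable

theorem integrable_ball_indicator (x : EuclideanSpace ℝ (Fin 3)) :
    Integrable (fun y => (Metric.ball (0 : EuclideanSpace ℝ (Fin 3)) 1).indicator
      (fun z => (‖z‖⁻¹) ^ 2) (x - y)) :=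
  ((integrable_indicator_iff Metric.isOpen_ball.measurableSet).2
    integrableOn_inv_norm_sq_ball).comp_sub_left x

theorem memLp_inv_norm_sub (hΩ : volume Ω ≠ ⊤) (x : EuclideanSpace ℝ (Fin 3)) :
    MemLp (fun y => ‖x - y‖⁻¹) 2 (volume.restrict Ω) := by
  have : IsFiniteMeasure (volume.restrict Ω) := ⟨by simpa using hΩ.lt_top⟩
  rw [memLp_two_iff_integrable_sq (aestronglyMeasurable_inv_norm_sub x _)]
  refine ((integrable_ball_indicator x).restrict.add (integrable_const (1 : ℝ))).mono'
    ((aestronglyMeasurable_inv_norm_sub x _).pow 2) (ae_of_all _ fun y => ?_)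
  rw [Real.norm_of_nonneg (by positivity)]
  exact inv_norm_sub_sq_le x y

theorem eLpNorm_inv_norm_sub_le (hΩ : volume Ω ≠ ⊤) (x : EuclideanSpace ℝ (Fin 3)) :
    (eLpNorm (fun y => ‖x - y‖⁻¹) 2 (volume.restrict Ω)).toReal
      ≤ kernelBound (volume Ω).toReal := by
  have : IsFiniteMeasure (volume.restrict Ω) := ⟨by simpa using hΩ.lt_top⟩
  refine Real.le_sqrt_of_sq_le ?_
  rw [toReal_eLpNorm_sq (memLp_inv_norm_sub hΩ x)]
  calc ∫ y in Ω, ‖‖x - y‖⁻¹‖ ^ 2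
      ≤ ∫ y in Ω, ((Metric.ball (0 : EuclideanSpace ℝ (Fin 3)) 1).indicator
          (fun z => (‖z‖⁻¹) ^ 2) (x - y) + 1) := by
        refine integral_mono ?_ ((integrable_ball_indicator x).restrict.add
          (integrable_const (1 : ℝ))) fun y => ?_
        · simpa using (memLp_inv_norm_sub hΩ x).integrable_sq
        · simpa using inv_norm_sub_sq_le x y
    _ = (∫ y in Ω, (Metric.ball (0 : EuclideanSpace ℝ (Fin 3)) 1).indicator
          (fun z => (‖z‖⁻¹) ^ 2) (x - y)) + (volume Ω).toReal := by
        rw [integral_add (integrable_ball_indicator x).restrict (integrable_const (1 : ℝ))]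
        simp [Measure.real]
    _ ≤ (∫ y, (Metric.ball (0 : EuclideanSpace ℝ (Fin 3)) 1).indicator
          (fun z => (‖z‖⁻¹) ^ 2) (x - y)) + (volume Ω).toReal := by
        refine add_le_add (setIntegral_le_integral (integrable_ball_indicator x)
          (ae_of_all _ fun y => ?_)) le_rfl
        exact Set.indicator_nonneg (fun _ _ => by positivity) _
    _ = _ := by
        rw [integral_sub_left_eq_self (fun z => (Metric.ball (0 : EuclideanSpace ℝ (Fin 3))
          1).indicator (fun z => (‖z‖⁻¹) ^ 2) z) volume x,
          integral_indicator Metric.isOpen_ball.measurableSet]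

theorem locallyIntegrable_inv_norm :
    LocallyIntegrable (fun x : EuclideanSpace ℝ (Fin 3) => ‖x‖⁻¹) := by
  rw [locallyIntegrable_iff]
  intro K hK
  have : IsFiniteMeasure (volume.restrict K) := ⟨by simpa using hK.measure_lt_top⟩
  have h := (memLp_inv_norm_sub hK.measure_lt_top.ne 0).integrable (by norm_num)
  simp only [zero_sub, norm_neg] at h
  exact h

end Kernel

/-! ### The fundamental solution of the Laplacian in dimension three -/

section FundamentalSolution

theorem contDiff_rpow_norm_sq_add {n : ℕ} {ε : ℝ} (hε : 0 < ε) (p : ℝ) :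
    ContDiff ℝ ∞ (fun y : EuclideanSpace ℝ (Fin n) => (‖y‖ ^ 2 + ε ^ 2) ^ p) :=
  ((contDiff_norm_sq ℝ).add contDiff_const).rpow_const_of_ne fun y => by positivity

theorem partial_rpow_norm_sq_add {n : ℕ} {ε : ℝ} (hε : 0 < ε) (p : ℝ)
    (y : EuclideanSpace ℝ (Fin n)) (i : Fin n) :
    gradient (fun y : EuclideanSpace ℝ (Fin n) => (‖y‖ ^ 2 + ε ^ 2) ^ p) y i
      = 2 * p * y i * (‖y‖ ^ 2 + ε ^ 2) ^ (p - 1) := by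
  have h1 : HasFDerivAt (fun y : EuclideanSpace ℝ (Fin n) => ‖y‖ ^ 2 + ε ^ 2)
      (2 • innerSL ℝ y) y := (hasStrictFDerivAt_norm_sq y).hasFDerivAt.add_const _
  have h2 := h1.rpow_const (p := p) (Or.inl (by positivity))
  rw [gradient_apply_eq_fderiv, h2.fderiv]
  simp [EuclideanSpace.inner_single_right]
  ring

theorem partial_coord {n : ℕ} (y : EuclideanSpace ℝ (Fin n)) (i : Fin n) :
    gradient (fun y : EuclideanSpace ℝ (Fin n) => y i) y i = 1 := by
  rw [gradient_apply_eq_fderiv]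
  have : HasFDerivAt (fun y : EuclideanSpace ℝ (Fin n) => y i)
      (EuclideanSpace.proj i : EuclideanSpace ℝ (Fin n) →L[ℝ] ℝ) y :=
    (EuclideanSpace.proj i : EuclideanSpace ℝ (Fin n) →L[ℝ] ℝ).hasFDerivAt
  rw [this.fderiv]
  simp

/-- With `s = |y|² + ε²`, the sum of second derivatives is `3|y|² s^(-5/2) - 3 s^(-3/2)`. In
dimension three the `|y|²` terms cancel and a multiple of `ε²` survives, which makes the result an
approximate identity. -/
theorem laplacian_rpow_norm_sq_add {ε : ℝ} (hε : 0 < ε) (y : EuclideanSpace ℝ (Fin 3)) :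
    laplacian (fun y : EuclideanSpace ℝ (Fin 3) => (‖y‖ ^ 2 + ε ^ 2) ^ (-1 / 2 : ℝ)) y
      = -(3 * ε ^ 2 * (‖y‖ ^ 2 + ε ^ 2) ^ (-5 / 2 : ℝ)) := by
  have hc : ∀ i : Fin 3, ContDiff ℝ ∞ (fun y : EuclideanSpace ℝ (Fin 3) => y i) := fun i =>
    (EuclideanSpace.proj i : EuclideanSpace ℝ (Fin 3) →L[ℝ] ℝ).contDiff
  have hi : ∀ i : Fin 3, gradient (fun y => gradient (fun y : EuclideanSpace ℝ (Fin 3) =>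
      (‖y‖ ^ 2 + ε ^ 2) ^ (-1 / 2 : ℝ)) y i) y i
      = 3 * (y i) ^ 2 * (‖y‖ ^ 2 + ε ^ 2) ^ (-5 / 2 : ℝ)
        - (‖y‖ ^ 2 + ε ^ 2) ^ (-3 / 2 : ℝ) := by
    intro i
    have h1 : (fun y => gradient (fun y : EuclideanSpace ℝ (Fin 3) =>
        (‖y‖ ^ 2 + ε ^ 2) ^ (-1 / 2 : ℝ)) y i)
        = fun y => (-1 * y i) * (‖y‖ ^ 2 + ε ^ 2) ^ (-3 / 2 : ℝ) := by
      ext y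
      rw [partial_rpow_norm_sq_add hε]
      norm_num
    rw [h1, gradient_mul (contDiff_const.mul (hc i)) (contDiff_rpow_norm_sq_add hε _),
      gradient_mul contDiff_const (hc i)]
    simp only [PiLp.add_apply, PiLp.smul_apply, smul_eq_mul, partial_rpow_norm_sq_add hε,
      partial_coord]
    have h0 : gradient (fun _ : EuclideanSpace ℝ (Fin 3) => (-1 : ℝ)) y = 0 := by
      simp [gradient]
    rw [h0]
    norm_num
    ring
  have hpow : (‖y‖ ^ 2 + ε ^ 2) ^ (-3 / 2 : ℝ)
      = (‖y‖ ^ 2 + ε ^ 2) ^ (-5 / 2 : ℝ) * (‖y‖ ^ 2 + ε ^ 2) := by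
    rw [← Real.rpow_add_one (by positivity)]
    norm_num
  rw [laplacian]
  simp only [hi, hpow, Fin.sum_univ_three]
  rw [EuclideanSpace.norm_sq_eq]
  simp only [Fin.sum_univ_three, Real.norm_eq_abs, sq_abs]
  ring

/-- The normalising constant of the fundamental solution of the Laplacian. -/
noncomputable def newtonConst : ℝ :=
  ∫ z : EuclideanSpace ℝ (Fin 3), 3 * (1 + ‖z‖ ^ 2) ^ (-5 / 2 : ℝ)

theorem integrable_newtonConst :
    Integrable (fun z : EuclideanSpace ℝ (Fin 3) => 3 * (1 + ‖z‖ ^ 2) ^ (-5 / 2 : ℝ)) :=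
  (integrable_rpow_neg_one_add_norm_sq (by simp; norm_num)).const_mul 3

theorem newtonConst_pos : 0 < newtonConst := by
  refine (integral_pos_iff_support_of_nonneg (fun z => by positivity) integrable_newtonConst).2 ?_
  have : Function.support (fun z : EuclideanSpace ℝ (Fin 3) =>
      3 * (1 + ‖z‖ ^ 2) ^ (-5 / 2 : ℝ)) = Set.univ :=
    Set.eq_univ_of_forall fun z => (by positivity : 3 * (1 + ‖z‖ ^ 2) ^ (-5 / 2 : ℝ) ≠ 0)
  rw [this]
  simp

/-- Substitute `y = ε z`: the powers `ε³` (Jacobian), `ε²` (prefactor) and `ε⁻⁵` (kernel) cancel. -/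
theorem integral_approx_identity {ε : ℝ} (hε : 0 < ε) (ψ : EuclideanSpace ℝ (Fin 3) → ℝ) :
    ∫ y, 3 * ε ^ 2 * (‖y‖ ^ 2 + ε ^ 2) ^ (-5 / 2 : ℝ) * ψ y
      = ∫ z, 3 * (1 + ‖z‖ ^ 2) ^ (-5 / 2 : ℝ) * ψ (ε • z) := by
  have h := Measure.integral_comp_smul (volume : Measure (EuclideanSpace ℝ (Fin 3)))
    (fun y => 3 * ε ^ 2 * (‖y‖ ^ 2 + ε ^ 2) ^ (-5 / 2 : ℝ) * ψ y) ε
  rw [finrank_euclideanSpace_fin, abs_of_pos (by positivity), smul_eq_mul,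
    eq_inv_mul_iff_mul_eq₀ (by positivity)] at h
  rw [← h, ← integral_const_mul]
  refine integral_congr_ae (ae_of_all _ fun z => ?_)
  have h1 : (‖ε • z‖ ^ 2 + ε ^ 2) ^ (-5 / 2 : ℝ)
      = (ε ^ 5)⁻¹ * (1 + ‖z‖ ^ 2) ^ (-5 / 2 : ℝ) := by
    rw [norm_smul, Real.norm_of_nonneg hε.le,
      show (ε * ‖z‖) ^ 2 + ε ^ 2 = ε ^ 2 * (1 + ‖z‖ ^ 2) by ring,
      Real.mul_rpow (by positivity) (by positivity), ← Real.rpow_natCast_mul hε.le]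
    norm_num
  simp only [h1]
  field_simp

/-- Green's identity holds for the regularised kernel `(|y|² + ε²)^(-1/2)`. As `ε → 0`, one side
tends to the singular integral and the other concentrates at the origin. Of the constant (in fact
`4π`), only positivity is needed later. -/
theorem integral_inv_norm_mul_laplacian {ψ : EuclideanSpace ℝ (Fin 3) → ℝ}
    (hψ : IsTestFunction Set.univ ψ) :
    ∫ y, ‖y‖⁻¹ * laplacian ψ y = -(newtonConst * ψ 0) := by
  have hL := hψ.laplacian
  let ε : ℕ → ℝ := fun k => 1 / ((k : ℝ) + 1)
  have hε : ∀ k, 0 < ε k := fun k => by positivity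
  have hε0 : Tendsto ε atTop (𝓝 0) := tendsto_one_div_add_atTop_nhds_zero_nat
  -- The regularised kernels lie below `1/|y|`, so `|Δψ|/|y|` is an integrable majorant.
  have h1 : Tendsto (fun k => ∫ y : EuclideanSpace ℝ (Fin 3),
      (‖y‖ ^ 2 + ε k ^ 2) ^ (-1 / 2 : ℝ) * laplacian ψ y) atTop
      (𝓝 (∫ y, ‖y‖⁻¹ * laplacian ψ y)) := by
    have hne : ∀ᵐ y : EuclideanSpace ℝ (Fin 3), y ≠ 0 := by
      simp [ae_iff]
    refine tendsto_integral_of_dominated_convergence (fun y => ‖y‖⁻¹ * ‖laplacian ψ y‖)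
      (fun k => ?_) ?_ (fun k => ?_) ?_
    · exact ((contDiff_rpow_norm_sq_add (hε k) _).continuous.mul
        hL.smooth.continuous).aestronglyMeasurable
    · simpa [mul_comm] using locallyIntegrable_inv_norm.integrable_smul_left_of_hasCompactSupport
        hL.smooth.continuous.norm hL.hasCompactSupport.norm
    · filter_upwards [hne] with y hy
      have hy' : 0 < ‖y‖ := norm_pos_iff.2 hy
      rw [norm_mul, Real.norm_of_nonneg (by positivity)]
      gcongr
      have : ‖y‖⁻¹ = (‖y‖ ^ 2) ^ (-1 / 2 : ℝ) := by
        rw [← Real.rpow_natCast_mul hy'.le]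
        norm_num [Real.rpow_neg_one]
      rw [this]
      exact Real.rpow_le_rpow_of_nonpos (by positivity) (by nlinarith [hε k]) (by norm_num)
    · filter_upwards [hne] with y hy
      have hy' : 0 < ‖y‖ := norm_pos_iff.2 hy
      refine Tendsto.mul_const _ ?_
      have : ‖y‖⁻¹ = (‖y‖ ^ 2 + 0 ^ 2) ^ (-1 / 2 : ℝ) := by
        rw [zero_pow two_ne_zero, add_zero, ← Real.rpow_natCast_mul hy'.le]
        norm_num [Real.rpow_neg_one]
      rw [this]
      exact ((hε0.pow 2).const_add _).rpow_const (Or.inl (by positivity))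
  have h2 : Tendsto (fun k => ∫ z : EuclideanSpace ℝ (Fin 3),
      3 * (1 + ‖z‖ ^ 2) ^ (-5 / 2 : ℝ) * ψ (ε k • z)) atTop
      (𝓝 (∫ z : EuclideanSpace ℝ (Fin 3), 3 * (1 + ‖z‖ ^ 2) ^ (-5 / 2 : ℝ) * ψ 0)) := by
    obtain ⟨B, hB⟩ := hψ.smooth.continuous.bounded_above_of_compact_support hψ.hasCompactSupport
    have hc : Continuous fun z : EuclideanSpace ℝ (Fin 3) =>
        3 * (1 + ‖z‖ ^ 2) ^ (-5 / 2 : ℝ) :=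
      continuous_const.mul ((by fun_prop : Continuous fun z : EuclideanSpace ℝ (Fin 3) =>
        1 + ‖z‖ ^ 2).rpow_const fun z => Or.inl (by positivity))
    refine tendsto_integral_of_dominated_convergence
      (fun z => 3 * (1 + ‖z‖ ^ 2) ^ (-5 / 2 : ℝ) * B) (fun k => ?_)
      (integrable_newtonConst.mul_const B) (fun k => ae_of_all _ fun z => ?_)
      (ae_of_all _ fun z => ?_)
    · exact (hc.mul (hψ.smooth.continuous.comp (continuous_const_smul _))).aestronglyMeasurable
    · rw [norm_mul, Real.norm_of_nonneg (by positivity)]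
      gcongr
      exact hB _
    · refine Tendsto.const_mul _ ?_
      have := hε0.smul_const z
      rw [zero_smul] at this
      exact (hψ.smooth.continuous.tendsto 0).comp this
  rw [integral_mul_const] at h2
  refine tendsto_nhds_unique h1 (h2.neg.congr fun k => ?_)
  rw [integral_mul_laplacian (contDiff_rpow_norm_sq_add (hε k) _) hψ.smooth hψ.hasCompactSupport,
    ← integral_approx_identity (hε k), ← integral_neg]
  refine integral_congr_ae (ae_of_all _ fun y => ?_)
  simp only [laplacian_rpow_norm_sq_add (hε k)]
  ring

end FundamentalSolution

/-! ### Newtonian potentials: bound, Poisson equation, continuity, symmetry -/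

section Potential

variable {Ω : Set (EuclideanSpace ℝ (Fin 3))}

/-- The Newtonian potential of a function on `Ω`, solving `-Δv = g`. -/
noncomputable def newtonPotential (Ω : Set (EuclideanSpace ℝ (Fin 3)))
    (g : EuclideanSpace ℝ (Fin 3) → ℝ) (x : EuclideanSpace ℝ (Fin 3)) : ℝ :=
  newtonConst⁻¹ * ∫ y in Ω, ‖x - y‖⁻¹ * g y

/-- The constant in the bound of the Newtonian potential by the `L²` norm of the density. -/
noncomputable def potentialBound (m : ℝ) : ℝ := newtonConst⁻¹ * kernelBound m

theorem potentialBound_nonneg (m : ℝ) : 0 ≤ potentialBound m :=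
  mul_nonneg (inv_nonneg.2 newtonConst_pos.le) (Real.sqrt_nonneg _)

theorem abs_newtonPotential_le (hΩ : volume Ω ≠ ⊤) {g : EuclideanSpace ℝ (Fin 3) → ℝ}
    (hg : MemLp g 2 (volume.restrict Ω)) (x : EuclideanSpace ℝ (Fin 3)) :
    |newtonPotential Ω g x| ≤ potentialBound (volume Ω).toReal *
      (eLpNorm g 2 (volume.restrict Ω)).toReal := by
  rw [newtonPotential, potentialBound, abs_mul, abs_of_pos (inv_pos.2 newtonConst_pos), mul_assoc]
  refine mul_le_mul_of_nonneg_left ?_ (inv_nonneg.2 newtonConst_pos.le)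
  refine (abs_integral_mul_le (memLp_inv_norm_sub hΩ x) hg).trans ?_
  gcongr
  exact eLpNorm_inv_norm_sub_le hΩ x

theorem newtonPotential_sub (hΩ : volume Ω ≠ ⊤) {g g' : EuclideanSpace ℝ (Fin 3) → ℝ}
    (hg : MemLp g 2 (volume.restrict Ω)) (hg' : MemLp g' 2 (volume.restrict Ω))
    (x : EuclideanSpace ℝ (Fin 3)) :
    newtonPotential Ω (fun y => g y - g' y) x
      = newtonPotential Ω g x - newtonPotential Ω g' x := by
  simp only [newtonPotential, mul_sub]
  rw [integral_sub, mul_sub]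
  · exact (memLp_inv_norm_sub hΩ x).integrable_mul hg
  · exact (memLp_inv_norm_sub hΩ x).integrable_mul hg'

theorem newtonPotential_eq_convolution {g : EuclideanSpace ℝ (Fin 3) → ℝ}
    (hg : IsTestFunction Ω g) :
    newtonPotential Ω g = fun x => newtonConst⁻¹ *
      ((fun y => ‖y‖⁻¹) ⋆[ContinuousLinearMap.lsmul ℝ ℝ, volume] g) x := by
  ext x
  rw [convolution_lsmul_swap, newtonPotential,
    setIntegral_eq_integral_of_tsupport_subset (tsupport_mul_subset_right.trans hg.tsupport_subset)]
  simp

theorem contDiff_newtonPotential {g : EuclideanSpace ℝ (Fin 3) → ℝ}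
    (hg : IsTestFunction Ω g) : ContDiff ℝ ∞ (newtonPotential Ω g) := by
  rw [newtonPotential_eq_convolution hg]
  exact contDiff_const.mul (hg.hasCompactSupport.contDiff_convolution_right _
    locallyIntegrable_inv_norm hg.smooth)

theorem partial_newtonPotential {g : EuclideanSpace ℝ (Fin 3) → ℝ}
    (hg : IsTestFunction Ω g) (x : EuclideanSpace ℝ (Fin 3)) (i : Fin 3) :
    gradient (newtonPotential Ω g) x i = newtonPotential Ω (fun y => gradient g y i) x := by
  have h1 : ContDiff ℝ 1 g := hg.smooth.of_le (by simp)
  have h := (hg.hasCompactSupport.hasFDerivAt_convolution_right (ContinuousLinearMap.lsmul ℝ ℝ)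
    locallyIntegrable_inv_norm h1 x).const_mul newtonConst⁻¹
  rw [newtonPotential_eq_convolution hg, newtonPotential_eq_convolution (hg.partialDeriv i),
    gradient_apply_eq_fderiv, h.fderiv, _root_.smul_apply,
    convolution_precompR_apply _ locallyIntegrable_inv_norm
      (hg.hasCompactSupport.fderiv ℝ) (h1.continuous_fderiv (by simp)), smul_eq_mul]
  simp_rw [gradient_apply_eq_fderiv]

theorem gradient_comp_const_sub {n : ℕ} {g : EuclideanSpace ℝ (Fin n) → ℝ}
    (hg : ContDiff ℝ ∞ g) (x t : EuclideanSpace ℝ (Fin n)) :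
    gradient (fun t => g (x - t)) t = - gradient g (x - t) := by
  have h : fderiv ℝ (fun t => g (x - t)) t = - fderiv ℝ g (x - t) := by
    have h1 := (hg.differentiable (by simp) (x - t)).hasFDerivAt.comp t
      ((hasFDerivAt_id t).const_sub x)
    refine h1.fderiv.trans ?_
    ext; simp
  simp [gradient, h]

theorem laplacian_comp_const_sub {n : ℕ} {g : EuclideanSpace ℝ (Fin n) → ℝ}
    (hg : ContDiff ℝ ∞ g) (x t : EuclideanSpace ℝ (Fin n)) :
    laplacian (fun t => g (x - t)) t = laplacian g (x - t) := by
  refine Finset.sum_congr rfl fun i _ => ?_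
  have h : (fun y => gradient (fun t => g (x - t)) y i)
      = fun y => (fun z => -gradient g z i) (x - y) := by
    ext y
    rw [gradient_comp_const_sub hg]
    rfl
  rw [h, gradient_comp_const_sub (g := fun z => -gradient g z i) (contDiff_partial hg i).neg]
  simp [gradient, fderiv_fun_neg]

/-- Derivatives of a convolution fall on the smooth factor, giving the potential of `Δg`. In the
variable `t = x - y` this is the fundamental-solution identity for `t ↦ g (x - t)`. -/
theorem laplacian_newtonPotential {g : EuclideanSpace ℝ (Fin 3) → ℝ}
    (hg : IsTestFunction Ω g) (x : EuclideanSpace ℝ (Fin 3)) :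
    laplacian (newtonPotential Ω g) x = - g x := by
  have h1 : laplacian (newtonPotential Ω g) x = newtonPotential Ω (laplacian g) x := by
    have hi : ∀ i, gradient (fun y => gradient (newtonPotential Ω g) y i) x i
        = newtonPotential Ω (fun y => gradient (fun y => gradient g y i) y i) x := fun i => by
      simp_rw [partial_newtonPotential hg]
      exact partial_newtonPotential (hg.partialDeriv i) x i
    rw [laplacian]
    simp only [hi]
    simp only [newtonPotential, laplacian]
    rw [← Finset.mul_sum, ← integral_finsetSum]
    · simp_rw [Finset.mul_sum]
    · intro i _
      have hi := (hg.partialDeriv i).partialDeriv i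
      have h2 : Integrable (fun y => ‖x - y‖⁻¹ *
          gradient (fun y => gradient g y i) y i) := by
        have := ((locallyIntegrable_inv_norm.integrable_smul_left_of_hasCompactSupport
          (g := fun z => gradient (fun y => gradient g y i) (x - z) i)
          (hi.smooth.continuous.comp (by fun_prop))
          (hi.hasCompactSupport.comp_homeomorph (Homeomorph.subLeft x)))).comp_sub_left x
        simpa [mul_comm] using this
      exact h2.restrict
  have hχ : IsTestFunction Set.univ (fun t => g (x - t)) :=
    ⟨hg.smooth.comp (contDiff_const.sub contDiff_id),
      hg.hasCompactSupport.comp_homeomorph (Homeomorph.subLeft x), Set.subset_univ _⟩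
  have h3 := integral_inv_norm_mul_laplacian hχ
  simp only [laplacian_comp_const_sub hg.smooth, sub_zero] at h3
  rw [h1, newtonPotential_eq_convolution hg.laplacian]
  simp only [convolution, ContinuousLinearMap.lsmul_apply, smul_eq_mul]
  rw [h3]
  field_simp [newtonConst_pos.ne']

/-- The pointwise bound is uniform in `x`, so `L²` approximation of `g` by test functions gives
uniform approximation of its potential by smooth ones. -/
theorem continuous_newtonPotential (hΩ : IsOpen Ω) (hΩ' : volume Ω ≠ ⊤)
    {g : EuclideanSpace ℝ (Fin 3) → ℝ} (hg : MemLp g 2 (volume.restrict Ω)) :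
    Continuous (newtonPotential Ω g) := by
  have hε : ∀ k : ℕ, (0 : ℝ) < 1 / ((k : ℝ) + 1) := fun k => by positivity
  choose φ hφ hle using fun k => exists_isTestFunction_eLpNorm_sub_le hΩ hg (hε k)
  have hlim : Tendsto (fun k : ℕ => potentialBound (volume Ω).toReal * (1 / ((k : ℝ) + 1)))
      atTop (𝓝 0) := by
    simpa using tendsto_one_div_add_atTop_nhds_zero_nat.const_mul
      (potentialBound (volume Ω).toReal)
  have hu : TendstoUniformly (fun k => newtonPotential Ω (φ k)) (newtonPotential Ω g) atTop := by
    rw [Metric.tendstoUniformly_iff]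
    intro δ hδ
    filter_upwards [hlim.eventually_lt_const hδ] with k hk x
    refine lt_of_le_of_lt ?_ hk
    have hm := (hφ k).memLp 2 (volume.restrict Ω)
    rw [Real.dist_eq, ← newtonPotential_sub hΩ' hg hm]
    refine (abs_newtonPotential_le hΩ' (hg.sub hm) x).trans ?_
    refine mul_le_mul_of_nonneg_left ?_ (potentialBound_nonneg _)
    exact ENNReal.toReal_le_of_le_ofReal (hε k).le (hle k)
  exact hu.continuous (Frequently.of_forall fun k => (contDiff_newtonPotential (hφ k)).continuous)

/-- Fubini and the symmetry of the kernel: the potential operator is self-adjoint. -/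
theorem integral_newtonPotential_mul (hΩ' : volume Ω ≠ ⊤)
    {g : EuclideanSpace ℝ (Fin 3) → ℝ} (hg : MemLp g 2 (volume.restrict Ω))
    {ψ : EuclideanSpace ℝ (Fin 3) → ℝ} (hψ : IsTestFunction Set.univ ψ) :
    ∫ x in Ω, newtonPotential Set.univ ψ x * g x = ∫ y, ψ y * newtonPotential Ω g y := by
  have hmeas : AEStronglyMeasurable (fun p : EuclideanSpace ℝ (Fin 3) × EuclideanSpace ℝ (Fin 3) =>
      ‖p.1 - p.2‖⁻¹ * ψ p.2 * g p.1) ((volume.restrict Ω).prod volume) := by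
    refine AEStronglyMeasurable.mul (AEStronglyMeasurable.mul ?_ ?_) hg.1.comp_fst
    · have : Measurable (fun p : EuclideanSpace ℝ (Fin 3) × EuclideanSpace ℝ (Fin 3) =>
        ‖p.1 - p.2‖⁻¹) := by fun_prop
      exact this.aestronglyMeasurable
    · exact (hψ.smooth.continuous.comp continuous_snd).aestronglyMeasurable
  have hint : Integrable (Function.uncurry fun x y => ‖x - y‖⁻¹ * ψ y * g x)
      ((volume.restrict Ω).prod volume) := by
    -- Integrating in `x` first, Cauchy–Schwarz bounds the inner integral by a constant times `|ψ
    -- y|`, which is integrable.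
    refine (integrable_prod_iff' hmeas).2 ?_
   
    refine ⟨ae_of_all _ fun y => ?_, ?_⟩
    · have := ((memLp_inv_norm_sub hΩ' y).integrable_mul hg).const_mul (ψ y)
      refine this.congr (ae_of_all _ fun x => ?_)
      simp [norm_sub_rev y x]
      ring
    · refine Integrable.mono' ((memLp_one_iff_integrable.1 (hψ.memLp 1 volume)).norm.mul_const
        (kernelBound (volume Ω).toReal * (eLpNorm g 2 (volume.restrict Ω)).toReal))
        hmeas.prod_swap.norm.integral_prod_right' (ae_of_all _ fun y => ?_)
      have h1 : ∫ x in Ω, ‖‖x - y‖⁻¹ * ψ y * g x‖ = ‖ψ y‖ * ∫ x in Ω, ‖y - x‖⁻¹ * |g x| := by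
        rw [← integral_const_mul]
        refine integral_congr_ae (ae_of_all _ fun x => ?_)
        simp [norm_sub_rev y x]
        ring
      simp only
      rw [h1, norm_mul, norm_norm]
      refine mul_le_mul_of_nonneg_left ?_ (norm_nonneg _)
      refine (abs_integral_mul_le (memLp_inv_norm_sub hΩ' y) hg.abs).trans ?_
      have h2 : eLpNorm |g| 2 (volume.restrict Ω)
          = eLpNorm g 2 (volume.restrict Ω) := eLpNorm_norm g
      rw [h2]
      gcongr
      exact eLpNorm_inv_norm_sub_le hΩ' y
  calc ∫ x in Ω, newtonPotential Set.univ ψ x * g x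
      = newtonConst⁻¹ * ∫ x in Ω, ∫ y, ‖x - y‖⁻¹ * ψ y * g x := by
        rw [← integral_const_mul]
        refine integral_congr_ae (ae_of_all _ fun x => ?_)
        simp only [newtonPotential, Measure.restrict_univ, integral_mul_const]
        ring
    _ = newtonConst⁻¹ * ∫ y, ∫ x in Ω, ‖x - y‖⁻¹ * ψ y * g x := by
        rw [integral_integral_swap hint]
    _ = ∫ y, ψ y * newtonPotential Ω g y := by
        rw [← integral_const_mul]
        refine integral_congr_ae (ae_of_all _ fun y => ?_)
        simp only [newtonPotential]
        rw [mul_left_comm, ← integral_const_mul (ψ y)]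
        congr 1
        refine integral_congr_ae (ae_of_all _ fun x => ?_)
        simp only [norm_sub_rev y x]
        ring

end Potential

/-! ### A smooth substitute for the positive part -/

section SmoothRamp

/-- A smooth nondecreasing function that vanishes exactly on `(-∞, 0]`, with derivative in
`[0, 1]`. -/
noncomputable def smoothRamp (t : ℝ) : ℝ := ∫ s in (0 : ℝ)..t, Real.smoothTransition s

theorem hasDerivAt_smoothRamp (t : ℝ) : HasDerivAt smoothRamp (Real.smoothTransition t) t :=
  (Real.smoothTransition.continuous.integral_hasStrictDerivAt 0 t).hasDerivAt

theorem contDiff_smoothRamp : ContDiff ℝ ∞ smoothRamp := by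
  refine contDiff_infty_iff_deriv.2
    ⟨fun t => (hasDerivAt_smoothRamp t).differentiableAt, ?_⟩
  rw [show deriv smoothRamp = Real.smoothTransition from
    funext fun t => (hasDerivAt_smoothRamp t).deriv]
  exact Real.smoothTransition.contDiff

theorem monotone_smoothRamp : Monotone smoothRamp :=
  monotone_of_hasDerivAt_nonneg hasDerivAt_smoothRamp fun t => Real.smoothTransition.nonneg t

theorem abs_smoothRamp_sub_le (s t : ℝ) : |smoothRamp s - smoothRamp t| ≤ |s - t| := by
  have h := Convex.norm_image_sub_le_of_norm_hasDerivWithin_le (s := Set.univ) (C := 1)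
    (fun x _ => (hasDerivAt_smoothRamp x).hasDerivWithinAt)
    (fun x _ => by
      rw [Real.norm_of_nonneg (Real.smoothTransition.nonneg x)]
      exact Real.smoothTransition.le_one x) convex_univ (Set.mem_univ t) (Set.mem_univ s)
  simpa using h

theorem smoothRamp_of_nonpos {t : ℝ} (ht : t ≤ 0) : smoothRamp t = 0 := by
  rw [smoothRamp, intervalIntegral.integral_symm, neg_eq_zero]
  refine intervalIntegral.integral_zero_ae (ae_of_all _ fun s hs => ?_)
  rw [Set.uIoc_of_le ht] at hs
  exact Real.smoothTransition.zero_of_nonpos hs.2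

theorem smoothRamp_nonneg (t : ℝ) : 0 ≤ smoothRamp t := by
  rcases le_total t 0 with ht | ht
  · exact (smoothRamp_of_nonpos ht).ge
  · rw [← smoothRamp_of_nonpos le_rfl]
    exact monotone_smoothRamp ht

theorem smoothRamp_pos {t : ℝ} (ht : 0 < t) : 0 < smoothRamp t :=
  intervalIntegral.intervalIntegral_pos_of_pos_on
    (Real.smoothTransition.continuous.intervalIntegrable 0 t)
    (fun _ hs => Real.smoothTransition.pos_of_pos hs.1) ht

end SmoothRamp

/-! ### The weak maximum principle and the upper bound -/

section Comparison

variable {Ω : Set (EuclideanSpace ℝ (Fin 3))}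

/-- The constant may depend on more than the measure of `Ω`. This is harmless, since it only
multiplies errors that tend to zero. -/
theorem exists_poincare_const (hΩ : Bornology.IsBounded Ω) :
    ∃ C : ℝ, 0 ≤ C ∧ ∀ φ, IsTestFunction Ω φ →
      (eLpNorm φ 2 (volume.restrict Ω)).toReal
        ≤ C * (eLpNorm (gradient φ) 2 (volume.restrict Ω)).toReal := by
  refine ⟨eLpNormLESNormFDerivOfLeConst ℝ
    (volume : Measure (EuclideanSpace ℝ (Fin 3))) Ω 2 2, NNReal.coe_nonneg _, fun φ hφ => ?_⟩
  have h := eLpNorm_le_eLpNorm_fderiv (p := 2) volume (hφ.smooth.of_le (by simp))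
    ((subset_tsupport φ).trans hφ.tsupport_subset) (by norm_num) (by simp; norm_num) hΩ
  have h2 : eLpNorm (fderiv ℝ φ) 2 volume = eLpNorm (gradient φ) 2 volume :=
    eLpNorm_congr_norm_ae (ae_of_all _ fun x => (norm_gradient φ x).symm)
  have h3 : (((2 : NNReal) : ENNReal)) = 2 := rfl
  rw [h3, h2] at h
  have h4 : Function.support φ ⊆ Ω := (subset_tsupport φ).trans hφ.tsupport_subset
  have h5 : Function.support (gradient φ) ⊆ Ω :=
    (subset_tsupport _).trans ((tsupport_gradient_subset φ).trans hφ.tsupport_subset)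
  rw [eLpNorm_restrict_eq_of_support_subset h4, eLpNorm_restrict_eq_of_support_subset h5]
  have := ENNReal.toReal_mono (ENNReal.mul_ne_top ENNReal.coe_ne_top
    (hφ.memLp_gradient 2 volume).eLpNorm_ne_top) h
  simpa using this

variable {n : ℕ} {U : Set (EuclideanSpace ℝ (Fin n))}
  {f u W : EuclideanSpace ℝ (Fin n) → ℝ}
  {G : EuclideanSpace ℝ (Fin n) → EuclideanSpace ℝ (Fin n)}

theorem gradient_smoothRamp_comp {v : EuclideanSpace ℝ (Fin n) → ℝ} (hv : ContDiff ℝ ∞ v)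
    (x : EuclideanSpace ℝ (Fin n)) :
    gradient (fun y => smoothRamp (v y)) x = Real.smoothTransition (v x) • gradient v x := by
  have h := (hasDerivAt_smoothRamp (v x)).comp_hasFDerivAt x
    (hv.differentiable (by simp) x).hasFDerivAt
  have h' : fderiv ℝ (fun y => smoothRamp (v y)) x = Real.smoothTransition (v x) • fderiv ℝ v x :=
    h.fderiv
  simp [gradient, h']

theorem gradient_sub_eq {v w : EuclideanSpace ℝ (Fin n) → ℝ} (hv : ContDiff ℝ ∞ v)
    (hw : ContDiff ℝ ∞ w) (x : EuclideanSpace ℝ (Fin n)) :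
    gradient (fun y => v y - w y) x = gradient v x - gradient w x := by
  simp [gradient, fderiv_fun_sub (hv.differentiable (by simp) x) (hw.differentiable (by simp) x)]

/-- Where `φ` vanishes, `φ - W ≤ 0` and the ramp vanishes too, so the support does not grow. -/
theorem IsTestFunction.smoothRamp_sub {φ : EuclideanSpace ℝ (Fin n) → ℝ}
    (hφ : IsTestFunction U φ) (hW : ContDiff ℝ ∞ W) (hW0 : ∀ x, 0 ≤ W x) :
    IsTestFunction U (fun x => smoothRamp (φ x - W x)) := by
  have hsub : tsupport (fun x => smoothRamp (φ x - W x)) ⊆ tsupport φ := by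
    refine closure_mono fun x hx => ?_
    by_contra h
    rw [Function.notMem_support] at h
    exact hx (smoothRamp_of_nonpos (by simpa [h] using hW0 x))
  exact ⟨contDiff_smoothRamp.comp (hφ.smooth.sub hW),
    hφ.hasCompactSupport.mono' ((subset_tsupport _).trans hsub), hsub.trans hφ.tsupport_subset⟩

/-- Energy estimate for `v`, the ramp of `φ - W`. Working with a smooth `φ` near `u` avoids any
chain rule in `H¹₀`; the price is the error `∇φ - G`. -/
theorem eLpNorm_smoothRamp_sub_testFunction_le {C : ℝ} (hC : 0 ≤ C)
    (hpc : ∀ φ, IsTestFunction U φ → (eLpNorm φ 2 (volume.restrict U)).toReal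
        ≤ C * (eLpNorm (gradient φ) 2 (volume.restrict U)).toReal)
    (hf : MemLp f 2 (volume.restrict U)) (hG : MemLp G 2 (volume.restrict U))
    (hw : ∀ φ, IsTestFunction U φ →
      ∫ x in U, inner ℝ (G x) (gradient φ x) = ∫ x in U, f x * φ x)
    {g : EuclideanSpace ℝ (Fin n) → ℝ} (hg : IsTestFunction U g) (hW : ContDiff ℝ ∞ W)
    (hW0 : ∀ x, 0 ≤ W x) (hWg : ∀ x, laplacian W x = - g x)
    {φ : EuclideanSpace ℝ (Fin n) → ℝ} (hφ : IsTestFunction U φ) :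
    (eLpNorm (fun x => smoothRamp (φ x - W x)) 2 (volume.restrict U)).toReal
      ≤ C * ((eLpNorm (fun x => gradient φ x - G x) 2 (volume.restrict U)).toReal
        + C * (eLpNorm (fun x => f x - g x) 2 (volume.restrict U)).toReal) := by
  set v := fun x => smoothRamp (φ x - W x) with hvdef
  have hv : IsTestFunction U v := hφ.smoothRamp_sub hW hW0
  have hgv : ∀ x, gradient v x
      = Real.smoothTransition (φ x - W x) • (gradient φ x - gradient W x) := fun x => by
    rw [hvdef, gradient_smoothRamp_comp (hφ.smooth.sub hW), gradient_sub_eq hφ.smooth hW]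
  set μ := volume.restrict U
  set a := (eLpNorm (gradient v) 2 μ).toReal with ha
  set e := (eLpNorm (fun x => gradient φ x - G x) 2 μ).toReal
  set d := (eLpNorm (fun x => f x - g x) 2 μ).toReal
  have hvm := hv.memLp 2 μ
  have hgvm := hv.memLp_gradient 2 μ
  have hgm := hg.memLp 2 μ
  have hgφm := hφ.memLp_gradient 2 μ
  have hiW : Integrable (fun x => inner ℝ (gradient W x) (gradient v x)) μ :=
    ((continuous_gradient hW).inner (continuous_gradient hv.smooth)).integrable_of_hasCompactSupport
      (hv.hasCompactSupport_gradient.mono fun x hx => by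
        rw [Function.mem_support] at hx ⊢
        intro h
        exact hx (by simp [h])) |>.restrict
  have hiφ : Integrable (fun x => inner ℝ (gradient φ x) (gradient v x)) μ :=
    integrable_inner_of_memLp hgφm hgvm
  have hW2 : ∫ x, inner ℝ (gradient W x) (gradient v x) ∂μ = ∫ x, g x * v x ∂μ := by
    have h := integral_inner_gradient hW hv.smooth hv.hasCompactSupport
    simp only [hWg, neg_mul, integral_neg, neg_neg] at h
    rw [setIntegral_eq_integral_of_tsupport_subset, h, setIntegral_eq_integral_of_tsupport_subset]
    · exact tsupport_mul_subset_left.trans hg.tsupport_subset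
    · refine (closure_mono fun x hx => ?_).trans
        ((tsupport_gradient_subset v).trans hv.tsupport_subset)
      rw [Function.mem_support] at hx ⊢
      intro h
      exact hx (by simp [h])
  -- With `θ` the slope of the ramp, `∇v = θ ∇(φ - W)`; since `0 ≤ θ ≤ 1`, `|∇v|² = θ² |∇(φ - W)|² ≤
  -- ∇(φ - W) · ∇v`.
  have h1 : a ^ 2 ≤ ∫ x, (inner ℝ (gradient φ x) (gradient v x)
      - inner ℝ (gradient W x) (gradient v x)) ∂μ := by
    rw [ha, toReal_eLpNorm_sq hgvm]
    refine integral_mono (by simpa using hgvm.integrable_norm_pow two_ne_zero)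
      (hiφ.sub hiW) fun x => ?_
    simp only
    rw [← inner_sub_left, hgv, inner_smul_right, real_inner_self_eq_norm_sq, norm_smul, mul_pow,
      Real.norm_of_nonneg (Real.smoothTransition.nonneg _)]
    refine mul_le_mul_of_nonneg_right ?_ (sq_nonneg _)
    exact pow_le_of_le_one (Real.smoothTransition.nonneg _) (Real.smoothTransition.le_one _)
      two_ne_zero
  have h2 : ∫ x, (inner ℝ (gradient φ x) (gradient v x)
      - inner ℝ (gradient W x) (gradient v x)) ∂μ
      = ∫ x, inner ℝ (gradient φ x - G x) (gradient v x) ∂μ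
        + ∫ x, (f x - g x) * v x ∂μ := by
    have hfv : Integrable (fun x => f x * v x) μ := hf.integrable_mul hvm
    have hgv' : Integrable (fun x => g x * v x) μ := hgm.integrable_mul hvm
    simp only [inner_sub_left, sub_mul]
    rw [integral_sub hiφ hiW, integral_sub hiφ (integrable_inner_of_memLp hG hgvm),
      integral_sub hfv hgv', hw v hv, hW2]
    ring
  -- Cauchy–Schwarz on both errors; Poincaré then turns `‖v‖₂` into `C a`, so that one factor `a`
  -- can be cancelled.
  have h3 : a ^ 2 ≤ (e + C * d) * a := by
    have hv' := hpc v hv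
    calc a ^ 2 ≤ _ := h1
      _ = _ := h2
      _ ≤ e * a + d * (eLpNorm v 2 μ).toReal :=
          add_le_add ((le_abs_self _).trans (abs_integral_inner_le (hgφm.sub hG) hgvm))
            ((le_abs_self _).trans (abs_integral_mul_le (hf.sub hgm) hvm))
      _ ≤ e * a + d * (C * a) := by gcongr
      _ = _ := by ring
  have ha0 : 0 ≤ a := ENNReal.toReal_nonneg
  have hd0 : 0 ≤ d := ENNReal.toReal_nonneg
  have he0 : 0 ≤ e := ENNReal.toReal_nonneg
  have h4 : a ≤ e + C * d := by
    rcases ha0.eq_or_lt with h | h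
    · rw [← h]; positivity
    · refine le_of_mul_le_mul_right ?_ h
      rwa [← pow_two]
  exact (hpc v hv).trans (mul_le_mul_of_nonneg_left h4 hC)

/-- Let `φ → u` in `H¹`: the gradient error vanishes, and the ramp is 1-Lipschitz, so it passes to
the `L²` limit. -/
theorem eLpNorm_smoothRamp_sub_le {C : ℝ} (hC : 0 ≤ C)
    (hpc : ∀ φ, IsTestFunction U φ → (eLpNorm φ 2 (volume.restrict U)).toReal
        ≤ C * (eLpNorm (gradient φ) 2 (volume.restrict U)).toReal)
    (hf : MemLp f 2 (volume.restrict U)) (hu : IsH10 U u G)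
    (hw : ∀ φ, IsTestFunction U φ →
      ∫ x in U, inner ℝ (G x) (gradient φ x) = ∫ x in U, f x * φ x)
    {g : EuclideanSpace ℝ (Fin n) → ℝ} (hg : IsTestFunction U g) (hW : ContDiff ℝ ∞ W)
    (hW0 : ∀ x, 0 ≤ W x) (hWg : ∀ x, laplacian W x = - g x) :
    eLpNorm (fun x => smoothRamp (u x - W x)) 2 (volume.restrict U)
      ≤ ENNReal.ofReal (C * (C *
        (eLpNorm (fun x => f x - g x) 2 (volume.restrict U)).toReal)) := by
  obtain ⟨φ, hφ, hφu, hφG⟩ := hu.approx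
  set μ := volume.restrict U
  set d := (eLpNorm (fun x => f x - g x) 2 μ).toReal
  have hmu : AEStronglyMeasurable (fun x => smoothRamp (u x - W x)) μ :=
    contDiff_smoothRamp.continuous.comp_aestronglyMeasurable
      (hu.isH1.memLp.1.sub hW.continuous.aestronglyMeasurable)
  have hle : ∀ k, eLpNorm (fun x => smoothRamp (u x - W x)) 2 μ
      ≤ eLpNorm (fun x => φ k x - u x) 2 μ + ENNReal.ofReal (C *
        ((eLpNorm (fun x => gradient (φ k) x - G x) 2 μ).toReal + C * d)) := fun k => by
    have hv := ((hφ k).smoothRamp_sub hW hW0).memLp 2 μ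
    have h1 : (fun x => smoothRamp (u x - W x))
        = (fun x => smoothRamp (u x - W x) - smoothRamp (φ k x - W x))
          + fun x => smoothRamp (φ k x - W x) := by
      ext x; simp
    rw [h1]
    refine (eLpNorm_add_le (hmu.sub hv.1) hv.1 (by norm_num)).trans (add_le_add ?_ ?_)
    · refine eLpNorm_mono fun x => ?_
      rw [Real.norm_eq_abs, Real.norm_eq_abs, abs_sub_comm (φ k x)]
      exact (abs_smoothRamp_sub_le _ _).trans (by rw [sub_sub_sub_cancel_right])
    · rw [← ENNReal.ofReal_toReal hv.eLpNorm_ne_top]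
      exact ENNReal.ofReal_le_ofReal
        (eLpNorm_smoothRamp_sub_testFunction_le hC hpc hf hu.isH1.memLp_grad hw hg hW hW0 hWg
          (hφ k))
  have hlim : Tendsto (fun k => eLpNorm (fun x => φ k x - u x) 2 μ + ENNReal.ofReal (C *
        ((eLpNorm (fun x => gradient (φ k) x - G x) 2 μ).toReal + C * d))) atTop
      (𝓝 (0 + ENNReal.ofReal (C * (0 + C * d)))) := by
    refine hφu.add ((ENNReal.continuous_ofReal.tendsto _).comp ?_)
    refine Tendsto.const_mul _ (Tendsto.add_const _ ?_)
    exact (ENNReal.tendsto_toReal ENNReal.zero_ne_top).comp hφG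
  simp only [zero_add] at hlim
  exact ge_of_tendsto' hlim hle

theorem laplacian_add_const {v : EuclideanSpace ℝ (Fin n) → ℝ} (c : ℝ)
    (x : EuclideanSpace ℝ (Fin n)) : laplacian (fun y => v y + c) x = laplacian v x := by
  simp [laplacian, gradient, fderiv_add_const]

theorem ae_le_of_isH10 (hΩ : IsOpen Ω) (hb : Bornology.IsBounded Ω)
    {f u : EuclideanSpace ℝ (Fin 3) → ℝ}
    {G : EuclideanSpace ℝ (Fin 3) → EuclideanSpace ℝ (Fin 3)}
    (hf : MemLp f 2 (volume.restrict Ω)) (hu : IsH10 Ω u G)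
    (hw : ∀ φ, IsTestFunction Ω φ →
      ∫ x in Ω, inner ℝ (G x) (gradient φ x) = ∫ x in Ω, f x * φ x) :
    ∀ᵐ x ∂volume.restrict Ω, u x ≤ 2 * potentialBound (volume Ω).toReal *
      (eLpNorm f 2 (volume.restrict Ω)).toReal := by
  obtain ⟨C, hC, hpc⟩ := exists_poincare_const hb
  have hvol : volume Ω ≠ ⊤ := hb.measure_lt_top.ne
  set μ := volume.restrict Ω
  set B := potentialBound (volume Ω).toReal
  have hB : 0 ≤ B := potentialBound_nonneg _
  set F := (eLpNorm f 2 μ).toReal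
  -- The threshold involves the fixed `δ` rather than `ε`, so the left side stays put while `ε → 0`.
  have key : ∀ δ : ℝ, 0 < δ → ∀ ε : ℝ, 0 < ε → ε ≤ δ →
      eLpNorm (fun x => smoothRamp (u x - 2 * B * (F + δ))) 2 μ
        ≤ ENNReal.ofReal (C * (C * ε)) := by
    intro δ hδ ε hε hεδ
    obtain ⟨g, hg, hfg⟩ := exists_isTestFunction_eLpNorm_sub_le hΩ hf hε
    have hgm := hg.memLp 2 μ
    set A := (eLpNorm g 2 μ).toReal
    have hAF : A ≤ F + ε := by
      have h1 : eLpNorm g 2 μ ≤ eLpNorm f 2 μ + eLpNorm (fun x => f x - g x) 2 μ := by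
        have h := eLpNorm_sub_le hf.1 (hf.sub hgm).1 (p := 2) (by norm_num)
        rw [sub_sub_cancel] at h
        exact h
      have h2 := ENNReal.toReal_mono (ENNReal.add_ne_top.2
        ⟨hf.eLpNorm_ne_top, ENNReal.ofReal_ne_top⟩) (h1.trans (add_le_add_right hfg _))
      rwa [ENNReal.toReal_add hf.eLpNorm_ne_top ENNReal.ofReal_ne_top,
        ENNReal.toReal_ofReal hε.le] at h2
    have hNP := abs_newtonPotential_le hvol hgm
    -- Adding the sup bound `B * A` of the potential makes `W` nonnegative and at most `2 * B * A`;
    -- this is the origin of the factor 2.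
    set W := fun x => newtonPotential Ω g x + B * A
    have hW0 : ∀ x, 0 ≤ W x := fun x => by
      have := (abs_le.1 (hNP x)).1
      change 0 ≤ newtonPotential Ω g x + B * A
      linarith
    have hWle : ∀ x, W x ≤ 2 * B * (F + δ) := fun x => by
      have h1 := (abs_le.1 (hNP x)).2
      have h2 : B * A ≤ B * (F + δ) := mul_le_mul_of_nonneg_left (by linarith) hB
      change newtonPotential Ω g x + B * A ≤ _
      linarith
    have hWg : ∀ x, laplacian W x = - g x := fun x => by
      rw [laplacian_add_const, laplacian_newtonPotential hg]
    have h := eLpNorm_smoothRamp_sub_le hC hpc hf hu hw hg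
      ((contDiff_newtonPotential hg).add contDiff_const) hW0 hWg
    refine (eLpNorm_mono fun x => ?_).trans (h.trans (ENNReal.ofReal_le_ofReal ?_))
    · rw [Real.norm_of_nonneg (smoothRamp_nonneg _), Real.norm_of_nonneg (smoothRamp_nonneg _)]
      exact monotone_smoothRamp (sub_le_sub_left (hWle x) _)
    · gcongr
      exact ENNReal.toReal_le_of_le_ofReal hε.le hfg
  have hδ : ∀ δ : ℝ, 0 < δ → ∀ᵐ x ∂μ, u x ≤ 2 * B * (F + δ) := by
    intro δ hδ
    have hlim : Tendsto (fun ε : ℝ => ENNReal.ofReal (C * (C * ε))) (𝓝[>] 0) (𝓝 0) := by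
      have : Continuous fun ε : ℝ => ENNReal.ofReal (C * (C * ε)) :=
        ENNReal.continuous_ofReal.comp (by fun_prop)
      simpa using (this.tendsto 0).mono_left nhdsWithin_le_nhds
    have h0 : eLpNorm (fun x => smoothRamp (u x - 2 * B * (F + δ))) 2 μ = 0 := by
      refine le_antisymm (ge_of_tendsto hlim ?_) bot_le
      filter_upwards [Ioc_mem_nhdsGT hδ] with ε hε
      exact key δ hδ ε hε.1 hε.2
    have hm : AEStronglyMeasurable (fun x => smoothRamp (u x - 2 * B * (F + δ))) μ :=
      contDiff_smoothRamp.continuous.comp_aestronglyMeasurable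
        (hu.isH1.memLp.1.sub aestronglyMeasurable_const)
    filter_upwards [(eLpNorm_eq_zero_iff hm two_ne_zero).1 h0] with x hx
    by_contra hlt
    exact (smoothRamp_pos (sub_pos.2 (not_le.1 hlt))).ne' hx
  have hall : ∀ᵐ x ∂μ, ∀ k : ℕ, u x ≤ 2 * B * (F + 1 / ((k : ℝ) + 1)) :=
    ae_all_iff.2 fun k => hδ _ (by positivity)
  filter_upwards [hall] with x hx
  have hlim : Tendsto (fun k : ℕ => 2 * B * (F + 1 / ((k : ℝ) + 1))) atTop
      (𝓝 (2 * B * (F + 0))) :=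
    (tendsto_one_div_add_atTop_nhds_zero_nat.const_add F).const_mul _
  rw [add_zero] at hlim
  exact ge_of_tendsto' hlim hx

end Comparison

/-! ### The equation satisfied by a cutoff of the solution -/

section Localization

variable {n : ℕ} {U : Set (EuclideanSpace ℝ (Fin n))} {u : EuclideanSpace ℝ (Fin n) → ℝ}
  {G : EuclideanSpace ℝ (Fin n) → EuclideanSpace ℝ (Fin n)}

theorem IsH1.integral_mul_divergence (hu : IsH1 U u G)
    {φ : Fin n → EuclideanSpace ℝ (Fin n) → ℝ} (hφ : ∀ i, IsTestFunction U (φ i)) :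
    ∫ x in U, u x * ∑ i, gradient (φ i) x i = - ∫ x in U, ∑ i, G x i * φ i x := by
  simp_rw [Finset.mul_sum]
  rw [integral_finsetSum, integral_finsetSum, ← Finset.sum_neg_distrib]
  · exact Finset.sum_congr rfl fun i _ => hu.weak_grad (φ i) (hφ i) i
  · intro i _
    have hGi : MemLp (fun x => G x i) 2 (volume.restrict U) :=
      hu.memLp_grad.of_le ((EuclideanSpace.proj i :
        EuclideanSpace ℝ (Fin n) →L[ℝ] ℝ).continuous.comp_aestronglyMeasurable
          hu.memLp_grad.1) (ae_of_all _ fun x => PiLp.norm_apply_le _ i)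
    exact hGi.integrable_mul ((hφ i).memLp 2 _)
  · exact fun i _ => hu.memLp.integrable_mul (((hφ i).partialDeriv i).memLp 2 _)

/-- `-Δ(ηu)` for a cutoff function `η` and a weak solution `u` of `-Δu = f`. -/
noncomputable def cutoffSource (η f u : EuclideanSpace ℝ (Fin n) → ℝ)
    (G : EuclideanSpace ℝ (Fin n) → EuclideanSpace ℝ (Fin n))
    (x : EuclideanSpace ℝ (Fin n)) : ℝ :=
  η x * f x - 2 * inner ℝ (G x) (gradient η x) - u x * laplacian η x

theorem memLp_cutoffSource {f η : EuclideanSpace ℝ (Fin n) → ℝ} (hη : IsTestFunction U η)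
    (hf : MemLp f 2 (volume.restrict U)) (hu : IsH1 U u G) :
    MemLp (cutoffSource η f u G) 2 (volume.restrict U) := by
  obtain ⟨B₁, hB₁⟩ := hη.smooth.continuous.bounded_above_of_compact_support hη.hasCompactSupport
  obtain ⟨B₂, hB₂⟩ := (continuous_gradient hη.smooth).bounded_above_of_compact_support
    hη.hasCompactSupport_gradient
  obtain ⟨B₃, hB₃⟩ := hη.laplacian.smooth.continuous.bounded_above_of_compact_support
    hη.laplacian.hasCompactSupport
  have h1 : MemLp (fun x => η x * f x) 2 (volume.restrict U) :=
    hf.of_le_mul (c := B₁) (hη.smooth.continuous.aestronglyMeasurable.mul hf.1)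
      (ae_of_all _ fun x => by
        rw [norm_mul]
        exact mul_le_mul_of_nonneg_right (hB₁ x) (norm_nonneg _))
  have h2 : MemLp (fun x => inner ℝ (G x) (gradient η x)) 2 (volume.restrict U) :=
    hu.memLp_grad.of_le_mul (c := B₂)
      (hu.memLp_grad.1.inner (continuous_gradient hη.smooth).aestronglyMeasurable)
      (ae_of_all _ fun x => by
        rw [mul_comm]
        exact (norm_inner_le_norm _ _).trans
          (mul_le_mul_of_nonneg_left (hB₂ x) (norm_nonneg _)))
  have h3 : MemLp (fun x => u x * laplacian η x) 2 (volume.restrict U) :=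
    hu.memLp.of_le_mul (c := B₃)
      (hu.memLp.1.mul hη.laplacian.smooth.continuous.aestronglyMeasurable)
      (ae_of_all _ fun x => by
        rw [norm_mul, mul_comm]
        exact mul_le_mul_of_nonneg_right (hB₃ x) (norm_nonneg _))
  exact (h1.sub (h2.const_mul 2)).sub h3

/-- Very weak form of the equation for `ηu`. It combines three identities: the weak equation tested
with `ηv`, and the weak gradient of `u` tested against the fields `η∇v` and `v∇η`. Only `η` has
compact support, so `v` can be a Newtonian potential. -/
theorem integral_cutoff_mul_laplacian {f η v : EuclideanSpace ℝ (Fin n) → ℝ}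
    (hη : IsTestFunction U η) (hv : ContDiff ℝ ∞ v)
    (hf : MemLp f 2 (volume.restrict U)) (hu : IsH1 U u G)
    (hw : ∀ φ, IsTestFunction U φ →
      ∫ x in U, inner ℝ (G x) (gradient φ x) = ∫ x in U, f x * φ x) :
    ∫ x in U, v x * cutoffSource η f u G x = - ∫ x in U, u x * (η x * laplacian v x) := by
  set μ := volume.restrict U
  have hgη := hη.hasCompactSupport_gradient
  have hgηc := continuous_gradient hη.smooth
  have hgvc := continuous_gradient hv
  have iA : Integrable (fun x => u x * (η x * laplacian v x)) μ :=
    hu.memLp.integrable_mul (q := 2) ((hη.smooth.continuous.mul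
      (continuous_laplacian hv)).memLp_of_hasCompactSupport hη.hasCompactSupport.mul_right)
  have iB : Integrable (fun x => u x * inner ℝ (gradient v x) (gradient η x)) μ := by
    refine hu.memLp.integrable_mul (q := 2) ((hgvc.inner hgηc).memLp_of_hasCompactSupport
      (hgη.mono fun x hx => ?_))
    rw [Function.mem_support] at hx ⊢
    intro h
    exact hx (by simp [h])
  have iD : Integrable (fun x => u x * (v x * laplacian η x)) μ :=
    hu.memLp.integrable_mul (q := 2) ((hv.continuous.mul
      hη.laplacian.smooth.continuous).memLp_of_hasCompactSupport
        hη.laplacian.hasCompactSupport.mul_left)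
  have iP : Integrable (fun x => inner ℝ (G x) (η x • gradient v x)) μ :=
    integrable_inner_of_memLp hu.memLp_grad
      ((hη.smooth.continuous.smul hgvc).memLp_of_hasCompactSupport
        hη.hasCompactSupport.smul_right)
  have iQ : Integrable (fun x => inner ℝ (G x) (v x • gradient η x)) μ :=
    integrable_inner_of_memLp hu.memLp_grad
      ((hv.continuous.smul hgηc).memLp_of_hasCompactSupport hgη.smul_left)
  have iR : Integrable (fun x => f x * (η x * v x)) μ :=
    hf.integrable_mul ((hη.mul_right hv).memLp 2 _)
  have e1 : ∫ x, inner ℝ (G x) (η x • gradient v x) ∂μ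
      + ∫ x, inner ℝ (G x) (v x • gradient η x) ∂μ = ∫ x, f x * (η x * v x) ∂μ := by
    rw [← integral_add iP iQ, ← hw _ (hη.mul_right hv)]
    simp_rw [gradient_mul hη.smooth hv, inner_add_right]
  have e2 : ∫ x, u x * (η x * laplacian v x) ∂μ
      + ∫ x, u x * inner ℝ (gradient v x) (gradient η x) ∂μ
      = - ∫ x, inner ℝ (G x) (η x • gradient v x) ∂μ := by
    have h := hu.integral_mul_divergence fun i => hη.mul_right (contDiff_partial hv i)
    rw [← integral_add iA iB]
    convert h using 2
    · ext x
      simp_rw [gradient_mul hη.smooth (contDiff_partial hv _)]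
      simp only [PiLp.add_apply, PiLp.smul_apply, smul_eq_mul, Finset.sum_add_distrib,
        ← Finset.mul_sum, inner_eq_sum_mul, laplacian]
      ring
    · congr 1
      ext x
      simp [inner_eq_sum_mul]
  have e3 : ∫ x, u x * inner ℝ (gradient v x) (gradient η x) ∂μ
      + ∫ x, u x * (v x * laplacian η x) ∂μ
      = - ∫ x, inner ℝ (G x) (v x • gradient η x) ∂μ := by
    have h := hu.integral_mul_divergence fun i => (hη.partialDeriv i).mul_right hv
    rw [← integral_add iB iD]
    convert h using 2
    · ext x
      simp_rw [gradient_mul (contDiff_partial hη.smooth _) hv]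
      simp only [PiLp.add_apply, PiLp.smul_apply, smul_eq_mul, Finset.sum_add_distrib,
        ← Finset.mul_sum, inner_eq_sum_mul, laplacian]
      rw [Finset.sum_congr rfl fun i _ => mul_comm (gradient v x i) (gradient η x i)]
      ring
    · congr 1
      ext x
      simp [inner_eq_sum_mul, mul_comm]
  have e4 : ∫ x, v x * cutoffSource η f u G x ∂μ = ∫ x, f x * (η x * v x) ∂μ
      - 2 * ∫ x, inner ℝ (G x) (v x • gradient η x) ∂μ
      - ∫ x, u x * (v x * laplacian η x) ∂μ := by
    have iRQ : Integrable (fun x => f x * (η x * v x)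
        - 2 * inner ℝ (G x) (v x • gradient η x)) μ := iR.sub (iQ.const_mul 2)
    rw [← integral_const_mul, ← integral_sub iR (iQ.const_mul 2), ← integral_sub iRQ iD]
    refine integral_congr_ae (ae_of_all _ fun x => ?_)
    simp only [cutoffSource, inner_smul_right]
    ring
  linarith

end Localization

/-! ### The continuous representative -/

section Continuity

variable {Ω : Set (EuclideanSpace ℝ (Fin 3))} {f u : EuclideanSpace ℝ (Fin 3) → ℝ}
  {G : EuclideanSpace ℝ (Fin 3) → EuclideanSpace ℝ (Fin 3)}

/-- Duality: write `N` for the potential and `g` for the source. For a test function `ψ` on the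
whole space, `∫ ψ N g = ∫ (N ψ) g = -∫ u η Δ(N ψ) = ∫ η u ψ`. Since `ψ` is arbitrary, the two
functions agree almost everywhere. -/
theorem ae_eq_newtonPotential_cutoffSource (hΩ : IsOpen Ω) (hvol : volume Ω ≠ ⊤)
    (hf : MemLp f 2 (volume.restrict Ω)) (hu : IsH1 Ω u G)
    (hw : ∀ φ, IsTestFunction Ω φ →
      ∫ x in Ω, inner ℝ (G x) (gradient φ x) = ∫ x in Ω, f x * φ x)
    {η : EuclideanSpace ℝ (Fin 3) → ℝ} (hη : IsTestFunction Ω η) :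
    ∀ᵐ x, η x * u x = newtonPotential Ω (cutoffSource η f u G) x := by
  have hg := memLp_cutoffSource hη hf hu
  have hη0 : ∀ x, x ∉ Ω → η x = 0 := fun x hx =>
    image_eq_zero_of_notMem_tsupport fun h => hx (hη.tsupport_subset h)
  have hint : Integrable (fun x => η x * u x) := by
    rw [← integrableOn_iff_integrable_of_support_subset (s := Ω)]
    · exact (hη.memLp 2 _).integrable_mul hu.memLp
    · intro x hx
      by_contra h
      exact hx (by simp [hη0 x h])
  refine ae_eq_of_integral_contDiff_smul_eq hint.locallyIntegrable
    (continuous_newtonPotential hΩ hvol hg).locallyIntegrable fun ψ hψ1 hψ2 => ?_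
  have hψ : IsTestFunction Set.univ ψ := ⟨hψ1, hψ2, Set.subset_univ _⟩
  simp only [smul_eq_mul]
  rw [← integral_newtonPotential_mul hvol hg hψ,
    integral_cutoff_mul_laplacian hη (contDiff_newtonPotential hψ) hf hu hw, ← integral_neg,
    ← setIntegral_eq_integral_of_forall_compl_eq_zero (s := Ω)
      (fun x hx => by rw [hη0 x hx]; ring)]
  refine integral_congr_ae (ae_of_all _ fun x => ?_)
  simp only [laplacian_newtonPotential hψ]
  ring

theorem exists_open_ae_eq_continuous (hΩ : IsOpen Ω) (hvol : volume Ω ≠ ⊤)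
    (hf : MemLp f 2 (volume.restrict Ω)) (hu : IsH1 Ω u G)
    (hw : ∀ φ, IsTestFunction Ω φ →
      ∫ x in Ω, inner ℝ (G x) (gradient φ x) = ∫ x in Ω, f x * φ x)
    {x : EuclideanSpace ℝ (Fin 3)} (hx : x ∈ Ω) :
    ∃ (O : Set (EuclideanSpace ℝ (Fin 3))) (W : EuclideanSpace ℝ (Fin 3) → ℝ),
      IsOpen O ∧ x ∈ O ∧ Continuous W ∧ u =ᵐ[volume.restrict O] W := by
  obtain ⟨r, hr, hball⟩ := Metric.nhds_basis_closedBall.mem_iff.1 (hΩ.mem_nhds hx)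
  -- The cutoff equals 1 on the half-radius ball, where `ηu = u`.
  let η : ContDiffBump x := ⟨r / 2, r, half_pos hr, half_lt_self hr⟩
  have hη : IsTestFunction Ω η := ⟨η.contDiff, η.hasCompactSupport, by
    rw [η.tsupport_eq]; exact hball⟩
  refine ⟨Metric.ball x (r / 2), _, Metric.isOpen_ball, Metric.mem_ball_self (half_pos hr),
    continuous_newtonPotential hΩ hvol (memLp_cutoffSource hη hf hu), ?_⟩
  refine (ae_restrict_iff' Metric.isOpen_ball.measurableSet).2 ?_
  filter_upwards [ae_eq_newtonPotential_cutoffSource hΩ hvol hf hu hw hη] with y hy hyb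
  rwa [η.one_of_mem_closedBall (Metric.ball_subset_closedBall hyb), one_mul] at hy

/-- Continuous functions that agree almost everywhere on an open set agree everywhere there, because
nonempty open sets have positive measure. Local representatives therefore coincide on overlaps, and
the diagonal choice `W x x` glues them. -/
theorem exists_continuousOn_ae_eq {X : Type*} [TopologicalSpace X] [SecondCountableTopology X]
    [MeasurableSpace X] [OpensMeasurableSpace X] {μ : Measure X} [μ.IsOpenPosMeasure]
    {S : Set X} (hS : IsOpen S) {u : X → ℝ}
    (h : ∀ x ∈ S, ∃ (O : Set X) (W : X → ℝ),
      IsOpen O ∧ x ∈ O ∧ Continuous W ∧ u =ᵐ[μ.restrict O] W) :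
    ∃ w : X → ℝ, ContinuousOn w S ∧ u =ᵐ[μ.restrict S] w := by
  classical
  choose! O W hO hxO hW hae using h
  have heq : ∀ x ∈ S, ∀ y ∈ S, y ∈ O x → W y y = W x y := by
    intro x hx y hy hyx
    have h1 : W y =ᵐ[μ.restrict (O x ∩ O y)] W x := by
      filter_upwards [ae_restrict_of_ae_restrict_of_subset Set.inter_subset_right (hae y hy),
        ae_restrict_of_ae_restrict_of_subset Set.inter_subset_left (hae x hx)] with z h2 h3
      exact h2.symm.trans h3
    exact Measure.eqOn_open_of_ae_eq h1 ((hO x hx).inter (hO y hy)) (hW y hy).continuousOn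
      (hW x hx).continuousOn ⟨hyx, hxO y hy⟩
  refine ⟨fun x => W x x, fun x hx => ?_, ?_⟩
  · refine ((hW x hx).continuousAt.congr ?_).continuousWithinAt
    filter_upwards [hS.mem_nhds hx, (hO x hx).mem_nhds (hxO x hx)] with y hy hyx
    exact (heq x hx y hy hyx).symm
  · rw [EventuallyEq, ae_restrict_iff' hS.measurableSet, ae_iff]
    -- Second countability reduces the uncountable family of neighbourhoods to a countable cover.
    refine measure_null_of_locally_null _ fun x hx => ?_
    have hxS : x ∈ S := by
      by_contra h
      exact hx fun h' => absurd h' h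
    refine ⟨{y | ¬(y ∈ S → u y = W y y)} ∩ O x,
      Filter.inter_mem self_mem_nhdsWithin
        (mem_nhdsWithin_of_mem_nhds ((hO x hxS).mem_nhds (hxO x hxS))), ?_⟩
    have h2 := (ae_restrict_iff' (hO x hxS).measurableSet).1 (hae x hxS)
    refine measure_mono_null ?_ (ae_iff.1 h2)
    rintro y ⟨hy, hyx⟩ hall
    exact hy fun hyS => (hall hyx).trans (heq x hxS y hyS hyx).symm

end Continuity

/-! ### The two-sided bound and the main theorem -/

theorem gradient_neg_eq {n : ℕ} (v : EuclideanSpace ℝ (Fin n) → ℝ)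
    (x : EuclideanSpace ℝ (Fin n)) : gradient (fun y => -v y) x = - gradient v x := by
  simp [gradient, fderiv_fun_neg]

theorem IsH10.neg {n : ℕ} {U : Set (EuclideanSpace ℝ (Fin n))}
    {u : EuclideanSpace ℝ (Fin n) → ℝ} {G : EuclideanSpace ℝ (Fin n) → EuclideanSpace ℝ (Fin n)}
    (hu : IsH10 U u G) : IsH10 U (fun x => - u x) (fun x => - G x) := by
  obtain ⟨φ, hφ, h1, h2⟩ := hu.approx
  refine ⟨⟨hu.isH1.memLp.neg, hu.isH1.memLp_grad.neg, fun ψ hψ i => ?_⟩,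
    fun k x => - φ k x, fun k => ?_, ?_, ?_⟩
  · simp [hu.isH1.weak_grad ψ hψ i, integral_neg]
  · simpa using (hφ k).mul_right (contDiff_const (c := (-1 : ℝ)))
  · refine h1.congr fun k => eLpNorm_congr_norm_ae (ae_of_all _ fun x => ?_)
    rw [neg_sub_neg, norm_sub_rev]
  · refine h2.congr fun k => eLpNorm_congr_norm_ae (ae_of_all _ fun x => ?_)
    rw [gradient_neg_eq, neg_sub_neg, norm_sub_rev]

theorem ae_abs_le_of_isH10 {Ω : Set (EuclideanSpace ℝ (Fin 3))} (hΩ : IsOpen Ω)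
    (hb : Bornology.IsBounded Ω) {f u : EuclideanSpace ℝ (Fin 3) → ℝ}
    {G : EuclideanSpace ℝ (Fin 3) → EuclideanSpace ℝ (Fin 3)}
    (hf : MemLp f 2 (volume.restrict Ω)) (hu : IsH10 Ω u G)
    (hw : ∀ φ, IsTestFunction Ω φ →
      ∫ x in Ω, inner ℝ (G x) (gradient φ x) = ∫ x in Ω, f x * φ x) :
    ∀ᵐ x ∂volume.restrict Ω, |u x| ≤ 2 * potentialBound (volume Ω).toReal *
      (eLpNorm f 2 (volume.restrict Ω)).toReal := by
  have h2 := ae_le_of_isH10 hΩ hb hf.neg hu.neg fun φ hφ => by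
    simp only [inner_neg_left, Pi.neg_apply, neg_mul, integral_neg, hw φ hφ]
  rw [eLpNorm_neg] at h2
  filter_upwards [ae_le_of_isH10 hΩ hb hf hu hw, h2] with x h3 h4
  exact abs_le.2 ⟨by linarith, h3⟩

end DirichletPoisson

theorem mainTheorem11 :
    ∃ C : ℝ → ℝ, (∀ m : ℝ, 0 < C m) ∧
      ∀ Ω : Set (EuclideanSpace ℝ (Fin 3)),
        IsOpen Ω → IsConnected Ω → Bornology.IsBounded Ω →
        ∀ f u : EuclideanSpace ℝ (Fin 3) → ℝ,
          MemLp f 2 (volume.restrict Ω) →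
          DirichletPoisson.IsWeakSolution Ω f u →
          (∃ w : EuclideanSpace ℝ (Fin 3) → ℝ,
            ContinuousOn w Ω ∧ u =ᵐ[volume.restrict Ω] w) ∧
          MemLp u ⊤ (volume.restrict Ω) ∧
          eLpNorm u ⊤ (volume.restrict Ω) ≤
            ENNReal.ofReal (C (volume Ω).toReal) * eLpNorm f 2 (volume.restrict Ω) := by
  -- The added 1 makes the constant strictly positive for every real `m`, where `potentialBound` is
  -- only known to be nonnegative.
  have hpos : ∀ m, 0 < 2 * DirichletPoisson.potentialBound m + 1 := fun m => by
    linarith [DirichletPoisson.potentialBound_nonneg m]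
  refine ⟨fun m => 2 * DirichletPoisson.potentialBound m + 1, hpos,
    fun Ω hΩ _ hb f u hf hsol => ?_⟩
  obtain ⟨G, hu, hweak⟩ := hsol
  have hw : ∀ φ, DirichletPoisson.IsTestFunction Ω φ →
      ∫ x in Ω, inner ℝ (G x) (gradient φ x) = ∫ x in Ω, f x * φ x :=
    fun φ hφ => hweak φ (gradient φ) hφ.isH10
  have hbound := DirichletPoisson.ae_abs_le_of_isH10 hΩ hb hf hu hw
  refine ⟨DirichletPoisson.exists_continuousOn_ae_eq hΩ fun x hx =>
    DirichletPoisson.exists_open_ae_eq_continuous hΩ hb.measure_lt_top.ne hf hu.isH1 hw hx,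
    memLp_top_of_bound hu.isH1.memLp.1 _ hbound, ?_⟩
  rw [eLpNorm_exponent_top]
  refine (eLpNormEssSup_le_of_ae_bound hbound).trans ?_
  rw [← ENNReal.ofReal_toReal hf.eLpNorm_ne_top, ← ENNReal.ofReal_mul (hpos _).le,
    ENNReal.toReal_ofReal ENNReal.toReal_nonneg]
  refine ENNReal.ofReal_le_ofReal (mul_le_mul_of_nonneg_right ?_ ENNReal.toReal_nonneg)
  linarith
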